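/- Let $G$ be a finite simple bipartite graph with bipartition $(X,Y)$ (so $X\cup Y=V(G)$, and every edge joins $X$ and $Y$; the graph and its classes may be empty). Definitions. Two edges of a graph are *independent* if they are disjoint and no edge of the graph joins them; for edges $xy,x'y'$ of a bipartite graph with $x,x'\in X$, $y,y'\in Y$ this says that $x\neq x'$, $y\neq y'$ and neither $xy'$ nor $x'y$ is an edge. $G$ is a *cocomparability bigraph* if there are linear orders $\prec_X$ of $X$ and $\prec_Y$ of $Y$ forming an *$S$-free pair*: for all $u,v\in X$ and $w,z\in Y$ with $u\prec_X v$, $w\prec_Y z$ and $uz,vw\in E(G)$, at least one of $uw,vz$ is in $E(G)$. An *orientation of $\overline G$* orients, in exactly one direction each, all edges of the complement $\overline G$ inside $X$ and inside $Y$ (i.e. all pairs of distinct vertices of the same class), while the edges of $\overline G$ between $X$ and $Y$ stay undirected. Let $G'$ be the bipartite complement of $G$: for $x\in X$, $y\in Y$, $xy\in E(G')$ if and only if $xy\notin E(G)$, and $G'$ has no other edges. An orientation is *$T$-free* if there are no $x,x'\in X$, $y,y'\in Y$ such that $xy,x'y'$ are independent edges of $G'$, $xx'$ is oriented from $x$ to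 $x'$ and $yy'$ from $y$ to $y'$. It is *acyclic* if it has no directed cycle. Two walks in $G$ that both begin in $X$ or both begin in $Y$ are *congruent* if they have the same length and for each $i$ their $i$-th edges are independent in $G$. Two distinct vertices $u,v$ form an *invertible pair* if there are congruent walks $W,W'$ in $G$ such that $W$ goes from $u$ to $v$ and $W'$ goes from $v$ to $u$. A *weak edge-asteroid* in $G$ consists of edges $e_0,\dots,e_{2k}$ of $G$ (not necessarily distinct) such that for each $i=0,\dots,2k$ there is a walk in $G$ starting at an end of $e_{i+k}$ and finishing at an end of $e_{i+k+1}$ which contains both ends of $e_{i+k}$ and both ends of $e_{i+k+1}$ but no vertex adjacent to an end of $e_i$ (subscripts modulo $2k+1$). It is an *edge-asteroid* if $e_0,\dots,e_{2k}$ are pairwise distinct. The *independence graph* $I(G)$ has the edges of $G$ as its vertices, two of them being adjacent if and only if they are independent in $G$. A *comparability graph* is a graph that has a transitive orientation. Theorem. The following statements are equivalent: (i) $G$ is a cocomparability bigraph; (ii) $\overline G$ has an acyclic $T$-free orientation; (iii) $\overline G$ has a $T$-free orientation; (iv) $G$ does not contain an invertible pair; (v) $G$ does not contain a weak edge-asteroid;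 (vi) $G$ does not contain an edge-asteroid; (vii) $I(G)$ is a comparability graph. In particular, a finite bipartite graph is a cocomparability bigraph if and only if it has no edge-asteroid. -/

import Mathlib

namespace Bigraph

variable {V : Type*}

/-- `G` is a bipartite graph with bipartition `(X, Y)`: the sets `X`, `Y` partition the vertex
set and every edge joins `X` and `Y`. -/
structure IsBipartition (G : SimpleGraph V) (X Y : Set V) : Prop where
  bipartite : G.IsBipartiteWith X Y
  cover : X ∪ Y = Set.univ

/-- Two edges are independent in `G` if they are disjoint and no edge of `G` joins them.
(In a bipartite graph with `x, x'` in one class and `y, y'` in the other, this says that `xy` and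
`x'y'` are disjoint and neither `xy'` nor `x'y` is an edge.) -/
def Independent (G : SimpleGraph V) (e f : Sym2 V) : Prop :=
  ∀ a ∈ e, ∀ b ∈ f, a ≠ b ∧ ¬ G.Adj a b

/-! ### Orderings -/

/-- The pair of strict relations `rX`, `rY` on `X`, `Y` is S-free. -/
def SFree (G : SimpleGraph V) (X Y : Set V) (rX : X → X → Prop) (rY : Y → Y → Prop) : Prop :=
  ∀ (u v : X) (w z : Y), rX u v → rY w z → G.Adj u z → G.Adj v w → G.Adj u w ∨ G.Adj v z

/-- `G`, with bipartition `(X, Y)`, is a cocomparability bigraph: there are strict linear orders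
of `X` and of `Y` that form an S-free pair. -/
def IsCocomparabilityBigraph (G : SimpleGraph V) (X Y : Set V) : Prop :=
  ∃ (rX : X → X → Prop) (rY : Y → Y → Prop),
    IsStrictTotalOrder X rX ∧ IsStrictTotalOrder Y rY ∧ SFree G X Y rX rY

/-! ### Orientations of the complement -/

/-- `a` and `b` lie in the same class of the bipartition. -/
def SameSide (X Y : Set V) (a b : V) : Prop :=
  (a ∈ X ∧ b ∈ X) ∨ (a ∈ Y ∧ b ∈ Y)

/-- The bipartite complement of `G` with respect to `(X, Y)`. -/
def bipartiteCompl (G : SimpleGraph V) (X Y : Set V) : SimpleGraph V :=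
  SimpleGraph.fromRel fun a b => a ∈ X ∧ b ∈ Y ∧ ¬ G.Adj a b

/-- An orientation of the complement of a bipartite graph with bipartition `(X, Y)`, given by its
set `D` of oriented edges: exactly the edges of the complement inside `X` and inside `Y` (that is,
all pairs of distinct vertices of the same class) are oriented, each in exactly one direction.
The edges of the complement between `X` and `Y` stay undirected. -/
structure IsOrientation (X Y : Set V) (D : V → V → Prop) : Prop where
  within : ∀ a b, D a b → a ≠ b ∧ SameSide X Y a b
  oriented : ∀ a b, a ≠ b → SameSide X Y a b → Xor (D a b) (D b a)

/-- The orientation `D` of the complement of `G` is T-free: no two independent edges `xy`, `x'y'`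
of the bipartite complement agree, i.e. neither are `xx'`, `yy'` both oriented edges, nor `x'x`,
`y'y`. -/
def TFree (G : SimpleGraph V) (X Y : Set V) (D : V → V → Prop) : Prop :=
  ∀ x ∈ X, ∀ x' ∈ X, ∀ y ∈ Y, ∀ y' ∈ Y,
    (bipartiteCompl G X Y).Adj x y → (bipartiteCompl G X Y).Adj x' y' →
    Independent (bipartiteCompl G X Y) s(x, y) s(x', y') →
    ¬ ((D x x' ∧ D y y') ∨ (D x' x ∧ D y' y))

/-- There is no directed cycle. -/
def Acyclic (D : V → V → Prop) : Prop :=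
  ∀ a, ¬ Relation.TransGen D a a

/-! ### Invertible pairs -/

/-- Two walks that begin in the same class of the bipartition are congruent if they have the same
length and for each `i` their `i`-th edges are independent. (`List.Forall₂` includes equality of
the lengths.) -/
def Congruent (G : SimpleGraph V) (X Y : Set V) {a b c d : V}
    (W : G.Walk a b) (W' : G.Walk c d) : Prop :=
  SameSide X Y a c ∧ List.Forall₂ (Independent G) W.edges W'.edges

/-- `u, v` is an invertible pair of `G`. -/
def IsInvertiblePair (G : SimpleGraph V) (X Y : Set V) (u v : V) : Prop :=
  u ≠ v ∧ ∃ (W : G.Walk u v) (W' : G.Walk v u), Congruent G X Y W W'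

/-! ### Edge-asteroids -/

/-- The edges `e 0, …, e (2k)` (repetitions allowed, indices modulo `2k+1`) form a weak
edge-asteroid: for each `i` there is a walk joining `e (i+k)` and `e (i+k+1)`, including both end
vertices of each of the two, that contains no vertex adjacent to an end of `e i`. -/
def IsWeakEdgeAsteroid (G : SimpleGraph V) (k : ℕ) (e : ZMod (2 * k + 1) → G.edgeSet) : Prop :=
  ∀ i : ZMod (2 * k + 1),
    ∃ a ∈ (e (i + k) : Sym2 V), ∃ b ∈ (e (i + k + 1) : Sym2 V), ∃ W : G.Walk a b,
      (∀ w ∈ (e (i + k) : Sym2 V), w ∈ W.support) ∧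
      (∀ w ∈ (e (i + k + 1) : Sym2 V), w ∈ W.support) ∧
      ∀ w ∈ W.support, ∀ c ∈ (e i : Sym2 V), ¬ G.Adj w c

/-- `G` contains a weak edge-asteroid. -/
def HasWeakEdgeAsteroid (G : SimpleGraph V) : Prop :=
  ∃ (k : ℕ) (e : ZMod (2 * k + 1) → G.edgeSet), IsWeakEdgeAsteroid G k e

/-- `G` contains an edge-asteroid: a weak edge-asteroid whose edges are pairwise distinct. -/
def HasEdgeAsteroid (G : SimpleGraph V) : Prop :=
  ∃ (k : ℕ) (e : ZMod (2 * k + 1) → G.edgeSet),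
    Function.Injective e ∧ IsWeakEdgeAsteroid G k e

/-! ### The independence graph -/

/-- The independence graph `I(G)`: its vertices are the edges of `G`, adjacent just if they are
independent. -/
def independenceGraph (G : SimpleGraph V) : SimpleGraph G.edgeSet where
  Adj e f := Independent G e f
  symm := ⟨fun _ _ h a ha b hb => ⟨(h b hb a ha).1.symm, fun hab => (h b hb a ha).2 hab.symm⟩⟩
  loopless := ⟨fun _ h => (h _ (Sym2.out_fst_mem _) _ (Sym2.out_fst_mem _)).1 rfl⟩

/-- A comparability graph: a graph that has a transitive orientation. -/
def IsComparabilityGraph {U : Type*} (H : SimpleGraph U) : Prop :=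
  ∃ r : U → U → Prop,
    (∀ a b, H.Adj a b ↔ r a b ∨ r b a) ∧ (∀ a b, r a b → ¬ r b a) ∧
    ∀ a b c, r a b → r b c → r a c

end Bigraph

namespace Bigraph

variable {V : Type*} {G : SimpleGraph V} {X Y : Set V}

/-! Everything is expressed through the forcing relation `Forces` on ordered pairs and its classes
`SameClass`. Passing to the bipartite complement turns independent edges into crossing ones, so an
orientation is T-free exactly when it is closed under forcing. An invertible pair is a pair of
vertices of one side whose class contains its own reverse. A T-free orientation rules this out, and
S-free linear orders provide an acyclic T-free orientation.

For the converse, suppose that no class is its own reverse. Each class is oriented so that its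
lexicographically least pair inside `X` is increasing. The triangle lemma `triangle` lets a side of
a hypothetical cyclic triangle be replaced by a least pair, which yields a contradiction. Pairs
outside nontrivial classes have comparable neighbourhoods and are ordered by inclusion, with ties
broken by an index; the result is transitive, and closure under forcing makes it S-free.

An acyclic T-free orientation orients `I(G)` transitively by comparing ends in `X`. In a transitive
orientation the arcs at a vertex `v` agree along each component of the complement of the
neighbourhood of `v`. Around a weak edge-asteroid this gives an odd number of reversals, which is
impossible.

To get distinct edges from a self-inverse class, split every vertex of `I(G)` into one copy per such
component. The class becomes an odd closed walk of the split graph. A shortest odd closed walk never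
uses two copies of one vertex (`not_oddGirthGE`), so it projects to a cycle of distinct edges of
`G`, which is an edge-asteroid after reindexing. -/

/-- The ordered pairs `p` and `q` force each other: `p.1 q.1` and `p.2 q.2` are edges, while
`p.1 q.2` and `p.2 q.1` are not. -/
def Forces (G : SimpleGraph V) (p q : V × V) : Prop :=
  G.Adj p.1 q.1 ∧ G.Adj p.2 q.2 ∧ ¬ G.Adj p.1 q.2 ∧ ¬ G.Adj p.2 q.1

/-- The implication classes of ordered pairs. -/
def SameClass (G : SimpleGraph V) : V × V → V × V → Prop :=
  Relation.ReflTransGen (Forces G)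

/-- The pair `p` lies in a nontrivial implication class, that is, the neighbourhoods of its
members are incomparable. -/
def IsNontrivial (G : SimpleGraph V) (p : V × V) : Prop := ∃ q, Forces G p q

theorem Forces.symm {p q : V × V} (h : Forces G p q) : Forces G q p :=
  ⟨h.1.symm, h.2.1.symm, fun k => h.2.2.2 k.symm, fun k => h.2.2.1 k.symm⟩

theorem Forces.swap {p q : V × V} (h : Forces G p q) : Forces G p.swap q.swap :=
  ⟨h.2.1, h.1, h.2.2.2, h.2.2.1⟩

theorem Forces.fst_ne_snd {p q : V × V} (h : Forces G p q) : p.1 ≠ p.2 :=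
  fun e => h.2.2.1 (e ▸ h.2.1)

namespace SameClass

theorem refl (p : V × V) : SameClass G p p := Relation.ReflTransGen.refl

theorem of_forces {p q : V × V} (h : Forces G p q) : SameClass G p q :=
  Relation.ReflTransGen.single h

theorem trans {p q r : V × V} (h : SameClass G p q) (h' : SameClass G q r) : SameClass G p r :=
  Relation.ReflTransGen.trans h h'

theorem symm {p q : V × V} (h : SameClass G p q) : SameClass G q p := by
  induction h with
  | refl => exact refl _
  | tail _ h ih => exact (of_forces h.symm).trans ih

theorem swap {p q : V × V} (h : SameClass G p q) : SameClass G p.swap q.swap := by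
  induction h with
  | refl => exact refl _
  | tail _ h ih => exact ih.trans (of_forces h.swap)

theorem isNontrivial {p q : V × V} (h : SameClass G p q) (hp : IsNontrivial G p) :
    IsNontrivial G q := by
  induction h with
  | refl => exact hp
  | tail _ h _ => exact ⟨_, h.symm⟩

end SameClass

theorem IsNontrivial.swap {p : V × V} (h : IsNontrivial G p) : IsNontrivial G p.swap :=
  let ⟨_, hq⟩ := h
  ⟨_, hq.swap⟩

/-! ### The triangle lemma -/

/-- A third vertex `a` and a forcing step `(b, c)`, `(β, γ)` extend to an induced `3K₂` or `C₆`. -/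
theorem exists_matching_or_hexagon {a b c β γ : V} (hab : IsNontrivial G (a, b))
    (h₁ : ¬ SameClass G (b, a) (b, c)) (h₂ : ¬ SameClass G (a, c) (b, c))
    (h : Forces G (b, c) (β, γ)) :
    ∃ α, (G.Adj a α ∧ ¬ G.Adj b α ∧ ¬ G.Adj c α ∧ ¬ G.Adj a β ∧ ¬ G.Adj a γ) ∨
      (¬ G.Adj a α ∧ G.Adj b α ∧ G.Adj c α ∧ G.Adj a β ∧ G.Adj a γ) := by
  obtain ⟨hbβ, hcγ, hbγ, hcβ⟩ := h
  dsimp only at hbβ hcγ hbγ hcβ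
  have hbc : SameClass G (β, γ) (b, c) := .of_forces ⟨hbβ.symm, hcγ.symm,
    fun k => hcβ k.symm, fun k => hbγ k.symm⟩
  obtain ⟨⟨α, δ⟩, haα, hbδ, haδ, hbα⟩ := hab
  dsimp only at haα hbδ haδ hbα
  by_cases haβ : G.Adj a β <;> by_cases haγ : G.Adj a γ
  · refine ⟨δ, .inr ⟨haδ, hbδ, by_contra fun hcδ => h₁ ?_, haβ, haγ⟩⟩
    exact .trans (.of_forces (q := (δ, γ)) ⟨hbδ, haγ, hbγ, haδ⟩)
      (.symm (.of_forces ⟨hbδ, hcγ, hbγ, hcδ⟩))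
  · exact (h₂ (.trans (.of_forces ⟨haβ, hcγ, haγ, hcβ⟩) hbc)).elim
  · exact (h₁ (.trans (.of_forces ⟨hbβ, haγ, hbγ, haβ⟩) hbc)).elim
  · refine ⟨α, .inl ⟨haα, hbα, fun hcα => h₁ ?_, haβ, haγ⟩⟩
    exact .trans (.of_forces (q := (β, α)) ⟨hbβ, haα, hbα, haβ⟩)
      (.symm (.of_forces ⟨hbβ, hcα, hbα, hcβ⟩))

/-- The vertex `α` of the `3K₂` or `C₆` carries the pairs at `a` across the two steps: it must miss
both `b'`, `c'` in the first case and see both in the second. Every other pattern would put `(b, a)`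
or `(a, c)` into the class of `(b, c)`. -/
theorem triangle_step {a b c β γ b' c' : V} (hab : IsNontrivial G (a, b))
    (h₁ : ¬ SameClass G (b, a) (b, c)) (h₂ : ¬ SameClass G (a, c) (b, c))
    (h : Forces G (b, c) (β, γ)) (h' : Forces G (β, γ) (b', c')) :
    SameClass G (a, b) (a, b') ∧ SameClass G (a, c) (a, c') := by
  obtain ⟨α, hα⟩ := exists_matching_or_hexagon hab h₁ h₂ h
  have hbc := SameClass.of_forces h.symm
  have hbc' := SameClass.of_forces h'.symm
  obtain ⟨hbβ, hcγ, hbγ, hcβ⟩ := h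
  obtain ⟨hβb', hγc', hβc', hγb'⟩ := h'
  dsimp only at hbβ hcγ hbγ hcβ hβb' hγc' hβc' hγb'
  rcases hα with ⟨haα, hbα, hcα, haβ, haγ⟩ | ⟨haα, hbα, hcα, haβ, haγ⟩
  · have e₁ : SameClass G (a, b) (α, β) := .of_forces ⟨haα, hbβ, haβ, hbα⟩
    have e₂ : SameClass G (a, c) (α, γ) := .of_forces ⟨haα, hcγ, haγ, hcα⟩
    by_cases hαb' : G.Adj α b' <;> by_cases hαc' : G.Adj α c'
    · refine (h₁ (e₁.swap.trans (.trans (.of_forces (q := (b, c')) ?_)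
        (.trans (.symm (.of_forces ?_)) hbc)))).elim
      · exact ⟨hbβ.symm, hαc', hβc', fun k => hbα k.symm⟩
      · exact ⟨hbβ.symm, hγc', hβc', fun k => hbγ k.symm⟩
    · refine (h₂ (e₂.trans (.trans (.of_forces (q := (b', c')) ?_) (hbc'.trans hbc)))).elim
      exact ⟨hαb', hγc', hαc', hγb'⟩
    · refine (h₁ (e₁.swap.trans (.trans (.of_forces (q := (b', c')) ?_) (hbc'.trans hbc)))).elim
      exact ⟨hβb', hαc', hβc', hαb'⟩
    · exact ⟨e₁.trans (.of_forces ⟨haα.symm, hβb', hαb', fun k => haβ k.symm⟩),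
        e₂.trans (.of_forces ⟨haα.symm, hγc', hαc', fun k => haγ k.symm⟩)⟩
  · have e₁ : SameClass G (a, b) (γ, α) := .of_forces ⟨haγ, hbα, haα, hbγ⟩
    have e₂ : SameClass G (a, c) (β, α) := .of_forces ⟨haβ, hcα, haα, hcβ⟩
    by_cases hαb' : G.Adj α b' <;> by_cases hαc' : G.Adj α c'
    · exact ⟨e₁.trans (.of_forces ⟨haγ.symm, hαb', hγb', fun k => haα k.symm⟩),
        e₂.trans (.of_forces ⟨haβ.symm, hαc', hβc', fun k => haα k.symm⟩)⟩
    · refine (h₁ (e₁.swap.trans (.trans (.of_forces (q := (b', c')) ?_) (hbc'.trans hbc)))).elim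
      exact ⟨hαb', hγc', hαc', hγb'⟩
    · refine (h₂ (e₂.trans (.trans (.of_forces (q := (b', c')) ?_) (hbc'.trans hbc)))).elim
      exact ⟨hβb', hαc', hβc', hαb'⟩
    · refine (h₁ (e₁.swap.trans (.trans (.of_forces (q := (b, c')) ?_)
        (.trans (.symm (.of_forces ?_)) hbc)))).elim
      · exact ⟨hbα.symm, hγc', hαc', fun k => hbγ k.symm⟩
      · exact ⟨hbβ.symm, hγc', hβc', fun k => hbγ k.symm⟩

theorem IsBipartition.mem_right (hG : IsBipartition G X Y) {a b : V} (h : G.Adj a b)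
    (ha : a ∈ X) : b ∈ Y := by
  rcases hG.bipartite.mem_of_adj h with h | h
  · exact h.2
  · exact (Set.disjoint_left.1 hG.bipartite.disjoint ha h.1).elim

theorem IsBipartition.mem_left (hG : IsBipartition G X Y) {a b : V} (h : G.Adj a b)
    (ha : a ∈ Y) : b ∈ X := by
  rcases hG.bipartite.mem_of_adj h with h | h
  · exact (Set.disjoint_left.1 hG.bipartite.disjoint h.1 ha).elim
  · exact h.2

theorem IsBipartition.not_mem_right (hG : IsBipartition G X Y) {a : V} (ha : a ∈ X) : a ∉ Y :=
  Set.disjoint_left.1 hG.bipartite.disjoint ha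

theorem IsBipartition.mem_or (hG : IsBipartition G X Y) (a : V) : a ∈ X ∨ a ∈ Y := by
  have : a ∈ X ∪ Y := hG.cover ▸ Set.mem_univ a
  exact this

/-- The triangle lemma: if the class of `(b, c)` contains neither `(b, a)` nor `(a, c)`, then
replacing `(b, c)` by a member of its class on the same side does not change the classes of
`(a, b)` and `(a, c)`. -/
theorem triangle (hG : IsBipartition G X Y) {a b c b' c' : V} (hab : IsNontrivial G (a, b))
    (h₁ : ¬ SameClass G (b, a) (b, c)) (h₂ : ¬ SameClass G (a, c) (b, c))
    (h : SameClass G (b, c) (b', c')) (hb : b ∈ X) (hb' : b' ∈ X) :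
    SameClass G (a, b) (a, b') ∧ SameClass G (a, c) (a, c') := by
  -- Forcing alternates sides, so the invariant advances two steps at a time; at members in `Y` only
  -- a predecessor satisfying it is remembered.
  have key : ∀ q, SameClass G (b, c) q →
      (q.1 ∈ X ∧ SameClass G (a, b) (a, q.1) ∧ SameClass G (a, c) (a, q.2)) ∨
      ∃ p, SameClass G (b, c) p ∧ Forces G p q ∧
        p.1 ∈ X ∧ SameClass G (a, b) (a, p.1) ∧ SameClass G (a, c) (a, p.2) := by
    intro q hq
    induction hq with
    | refl => exact .inl ⟨hb, .refl _, .refl _⟩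
    | @tail q r hq hqr ih =>
      rcases ih with ih | ⟨p, hp, hpq, hpX, e₁, e₂⟩
      · exact .inr ⟨q, hq, hqr, ih⟩
      · left
        have := triangle_step (a := a) (b := p.1) (c := p.2) (e₁.isNontrivial hab)
          (fun k => h₁ (e₁.swap.trans (k.trans hp.symm)))
          (fun k => h₂ (e₂.trans (k.trans hp.symm))) hpq hqr
        exact ⟨hG.mem_left hqr.1 (hG.mem_right hpq.1 hpX), e₁.trans this.1, e₂.trans this.2⟩
  rcases key _ h with h | ⟨p, -, hp, hpX, -⟩
  · exact h.2
  · exact (hG.not_mem_right hb' (hG.mem_right hp.1 hpX)).elim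

/-! ### The lexicographic orientation -/

section Lex

variable (ix : V → ℕ)

/-- The key of an unordered pair, for the lexicographic order. -/
def lexKey (p : V × V) : ℕ ×ₗ ℕ :=
  toLex (min (ix p.1) (ix p.2), max (ix p.1) (ix p.2))

/-- The lexicographic orientation of the pairs that lie in nontrivial classes: every class is
oriented in such a way that its least pair inside `X` is increasing. -/
def LexOriented (G : SimpleGraph V) (X : Set V) (a b : V) : Prop :=
  ∃ p : V × V, p.1 ∈ X ∧ SameClass G p (a, b) ∧ ix p.1 < ix p.2 ∧
    ∀ q : V × V, q.1 ∈ X → q.2 ∈ X → SameClass G q (a, b) ∨ SameClass G q.swap (a, b) →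
      lexKey ix p ≤ lexKey ix q

variable {ix}

theorem lexKey_swap (p : V × V) : lexKey ix p.swap = lexKey ix p := by
  simp [lexKey, min_comm, max_comm]

theorem lexKey_of_lt {p : V × V} (h : ix p.1 < ix p.2) :
    lexKey ix p = toLex (ix p.1, ix p.2) := by
  simp [lexKey, h.le]

theorem LexOriented.congr {a b c d : V} (h : LexOriented ix G X a b)
    (e : SameClass G (a, b) (c, d)) : LexOriented ix G X c d := by
  obtain ⟨p, hp, hpa, hlt, hmin⟩ := h
  exact ⟨p, hp, hpa.trans e, hlt, fun q hq hq' hqc => hmin q hq hq'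
    (hqc.imp (fun k => k.trans e.symm) fun k => k.trans e.symm)⟩

theorem SameClass.sameSide (hG : IsBipartition G X Y) {p q : V × V} (h : SameClass G p q)
    (hp : SameSide X Y p.1 p.2) : SameSide X Y q.1 q.2 := by
  induction h with
  | refl => exact hp
  | tail _ h ih =>
    rcases ih with ih | ih
    · exact .inr ⟨hG.mem_right h.1 ih.1, hG.mem_right h.2.1 ih.2⟩
    · exact .inl ⟨hG.mem_left h.1 ih.1, hG.mem_left h.2.1 ih.2⟩

theorem LexOriented.total (hix : Function.Injective ix) (hG : IsBipartition G X Y) {a b : V}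
    (hab : SameSide X Y a b) (h : IsNontrivial G (a, b)) :
    LexOriented ix G X a b ∨ LexOriented ix G X b a := by
  let S : Set (V × V) := {q | q.1 ∈ X ∧ q.2 ∈ X ∧
    (SameClass G q (a, b) ∨ SameClass G q.swap (a, b))}
  have hS : S.Nonempty := by
    rcases hab with hX | hY
    · exact ⟨(a, b), hX.1, hX.2, .inl (.refl _)⟩
    · obtain ⟨q, hq⟩ := h
      exact ⟨q, hG.mem_left hq.1 hY.1, hG.mem_left hq.2.1 hY.2, .inl (.of_forces hq.symm)⟩
  obtain ⟨p, ⟨hp₁, hp₂, hp⟩, hmin⟩ : ∃ p ∈ S, ∀ q ∈ S, lexKey ix p ≤ lexKey ix q := by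
    obtain ⟨-, ⟨p, hp, rfl⟩, hm⟩ :=
      (wellFounded_lt (α := ℕ ×ₗ ℕ)).has_min (lexKey ix '' S) (hS.image _)
    exact ⟨p, hp, fun q hq => not_lt.1 (hm _ ⟨q, hq, rfl⟩)⟩
  have hne : p.1 ≠ p.2 := by
    rcases hp with hp | hp
    · obtain ⟨q, hq⟩ := hp.symm.isNontrivial h
      exact hq.fst_ne_snd
    · obtain ⟨q, hq⟩ := hp.symm.isNontrivial h
      exact hq.fst_ne_snd.symm
  have hmin' : ∀ q : V × V, q.1 ∈ X → q.2 ∈ X →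
      SameClass G q (a, b) ∨ SameClass G q.swap (a, b) → lexKey ix p ≤ lexKey ix q :=
    fun q h₁ h₂ h => hmin q ⟨h₁, h₂, h⟩
  have hmin'' : ∀ q : V × V, q.1 ∈ X → q.2 ∈ X →
      SameClass G q (b, a) ∨ SameClass G q.swap (b, a) → lexKey ix p ≤ lexKey ix q :=
    fun q h₁ h₂ h => hmin q ⟨h₁, h₂, h.symm.imp (fun k => k.swap) fun k => k.swap⟩
  rcases lt_or_gt_of_ne (hix.ne hne) with hlt | hlt
  · rcases hp with hp | hp
    · exact .inl ⟨p, hp₁, hp, hlt, hmin'⟩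
    · exact .inr ⟨p, hp₁, hp.swap, hlt, hmin''⟩
  · rw [← lexKey_swap] at hmin' hmin''
    rcases hp with hp | hp
    · exact .inr ⟨p.swap, hp₂, hp.swap, hlt, hmin''⟩
    · exact .inl ⟨p.swap, hp₂, hp, hlt, hmin'⟩

theorem SameClass.snd_mem_of_fst_mem (hG : IsBipartition G X Y) {p q : V × V}
    (h : SameClass G p q) (hp : p.1 ∈ X) (hq : SameSide X Y q.1 q.2) : p.2 ∈ X := by
  rcases h.symm.sameSide hG hq with h | h
  · exact h.2
  · exact (hG.not_mem_right hp h.1).elim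

/-- Both orientations would be witnessed by least pairs with the same key. Both being increasing,
they coincide, so the class would be its own reverse. -/
theorem LexOriented.asymm (hix : Function.Injective ix) (hG : IsBipartition G X Y) {a b : V}
    (hab : SameSide X Y a b) (hinv : ¬ SameClass G (a, b) (b, a))
    (h : LexOriented ix G X a b) : ¬ LexOriented ix G X b a := by
  rintro ⟨q, hq, hqb, hlt', hmin'⟩
  obtain ⟨p, hp, hpa, hlt, hmin⟩ := h
  have hp₂ := SameClass.snd_mem_of_fst_mem hG hpa hp hab
  have hq₂ := SameClass.snd_mem_of_fst_mem hG hqb hq (hab.imp And.symm And.symm)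
  have e : lexKey ix p = lexKey ix q :=
    le_antisymm (hmin q hq hq₂ (.inr hqb.swap)) (hmin' p hp hp₂ (.inr hpa.swap))
  rw [lexKey_of_lt hlt, lexKey_of_lt hlt', toLex_inj, Prod.mk.injEq] at e
  have : p = q := Prod.ext (hix e.1) (hix e.2)
  subst this
  exact hinv (hpa.symm.trans hqb)

/-- No class is inverse to itself; this is the absence of invertible pairs. -/
def NoSelfInverse (G : SimpleGraph V) (X Y : Set V) : Prop :=
  ∀ a b, a ≠ b → SameSide X Y a b → ¬ SameClass G (a, b) (b, a)

/-- The triangle lemma replaces `(b, c)` by its least pair `q = (b', c')`. Minimality of `p` then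
forces `p` to begin at `b'`, and a second application, moving `(a, b')` to `p`, puts `(c', a)` and
`(c', b')` in one class, against `b'` preceding `c'`. -/
theorem not_cyclic_of_least (hix : Function.Injective ix) (hG : IsBipartition G X Y)
    (hinv : NoSelfInverse G X Y) {a b c : V} (ha : a ∈ X) (hb : b ∈ X)
    (hac : IsNontrivial G (a, c)) (hab : IsNontrivial G (a, b))
    {p q : V × V} (hp : p.1 ∈ X)
    (hpa : SameClass G p (a, b)) (hlt : ix p.1 < ix p.2)
    (hmin : ∀ r : V × V, r.1 ∈ X → r.2 ∈ X → SameClass G r (a, b) ∨ SameClass G r.swap (a, b) →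
      lexKey ix p ≤ lexKey ix r)
    (hq : q.1 ∈ X) (hqb : SameClass G q (b, c)) (hlt' : ix q.1 < ix q.2)
    (hle : lexKey ix q ≤ lexKey ix p) (hc : c ∈ X)
    (hDab : LexOriented ix G X a b) (hDbc : LexOriented ix G X b c)
    (hDca : LexOriented ix G X c a) : False := by
  have asymm : ∀ {x y : V}, x ∈ X → y ∈ X → x ≠ y → LexOriented ix G X x y →
      ¬ LexOriented ix G X y x := fun hx hy hxy h =>
    h.asymm hix hG (.inl ⟨hx, hy⟩) (hinv _ _ hxy (.inl ⟨hx, hy⟩))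
  have ne_of {x y : V} (h : IsNontrivial G (x, y)) : x ≠ y :=
    let ⟨_, h⟩ := h
    h.fst_ne_snd
  have nab := ne_of hab
  have nac := ne_of hac
  obtain ⟨b', c'⟩ := q
  dsimp only at hq hlt'
  have hc' : c' ∈ X := SameClass.snd_mem_of_fst_mem hG hqb hq (.inl ⟨hb, hc⟩)
  have nbc : b ≠ c := by
    rintro rfl
    exact asymm ha hb nab hDab hDca
  have h₁ : ¬ SameClass G (b, a) (b, c) := fun k => asymm ha hb nab hDab (hDbc.congr k.symm)
  have h₂ : ¬ SameClass G (a, c) (b, c) := fun k => asymm ha hc nac (hDbc.congr k.symm) hDca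
  obtain ⟨e₁, e₂⟩ := triangle hG hab h₁ h₂ hqb.symm hb hq
  have dab := hDab.congr e₁
  have dca := hDca.congr e₂.swap
  have dbc := hDbc.congr hqb.symm
  have nab' := ne_of (e₁.isNontrivial hab)
  have nac' := ne_of (e₂.isNontrivial hac)
  have nbc' : b' ≠ c' := by
    rintro rfl
    exact lt_irrefl _ hlt'
  have hle₂ : lexKey ix p ≤ lexKey ix (a, b') := hmin _ ha hq (.inl e₁.symm)
  have hle₃ := hle.trans hle₂
  rw [lexKey_of_lt hlt'] at hle hle₃
  have hba : ix b' < ix a := by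
    refine lt_of_le_of_ne ?_ (hix.ne nab'.symm)
    rw [lexKey, Prod.Lex.toLex_le_toLex] at hle₃
    rcases hle₃ with h | h
    · exact (lt_min_iff.1 h).1.le
    · exact (le_min_iff.1 h.1.le).1
  obtain ⟨u, v⟩ := p
  -- `q ≤ p` bounds `u` below by `b'`, and `p ≤ (a, b')`, whose smaller index is that of `b'`,
  -- bounds it above.
  have hu : u = b' := by
    rw [← lexKey_swap (a, b'), lexKey_of_lt (p := (a, b').swap) hba, lexKey_of_lt hlt,
      Prod.Lex.toLex_le_toLex] at hle₂
    rw [lexKey_of_lt hlt, Prod.Lex.toLex_le_toLex] at hle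
    dsimp only [Prod.swap] at hle hle₂
    exact hix (by omega)
  subst hu
  have h₃ : ¬ SameClass G (a, c') (a, u) := fun k =>
    asymm ha hc' nac' (dab.congr k.symm) dca
  have h₄ : ¬ SameClass G (c', u) (a, u) := fun k =>
    asymm hq hc' nbc' dbc (dab.congr k.symm)
  obtain ⟨e, -⟩ := triangle hG (e₂.isNontrivial hac).swap h₃ h₄ (e₁.symm.trans hpa.symm) ha hq
  exact asymm hq hc' nbc' dbc (dca.congr e)

theorem not_cyclic_of_mem (hix : Function.Injective ix) (hG : IsBipartition G X Y)
    (hinv : NoSelfInverse G X Y) {a b c : V} (ha : a ∈ X) (hb : b ∈ X) (hc : c ∈ X)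
    (hab : IsNontrivial G (a, b)) (hbc : IsNontrivial G (b, c)) (hca : IsNontrivial G (c, a))
    (dab : LexOriented ix G X a b) (dbc : LexOriented ix G X b c)
    (dca : LexOriented ix G X c a) : False := by
  obtain ⟨p, hp, hpa, hplt, hpmin⟩ := id dab
  obtain ⟨q, hq, hqb, hqlt, hqmin⟩ := id dbc
  obtain ⟨r, hr, hrc, hrlt, hrmin⟩ := id dca
  -- The three least keys cannot increase strictly all the way round the cycle, so some rotation
  -- satisfies the hypothesis of `not_cyclic_of_least`.
  by_cases h₁ : lexKey ix q ≤ lexKey ix p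
  · exact not_cyclic_of_least hix hG hinv ha hb hca.swap hab hp hpa hplt hpmin hq hqb hqlt h₁ hc
      dab dbc dca
  · by_cases h₂ : lexKey ix p ≤ lexKey ix r
    · exact not_cyclic_of_least hix hG hinv hc ha hbc.swap hca hr hrc hrlt hrmin hp hpa hplt h₂ hb
        dca dab dbc
    · exact not_cyclic_of_least hix hG hinv hb hc hab.swap hbc hq hqb hqlt hqmin hr hrc hrlt
        ((not_le.1 h₂).le.trans (not_le.1 h₁).le) ha dbc dca dab

/-- A cyclic triangle in `Y` is transported to `X`: in an induced `3K₂` or `C₆` its three sides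
force the three sides of a cyclic triangle on the other class. -/
theorem LexOriented.not_cyclic (hix : Function.Injective ix) (hG : IsBipartition G X Y)
    (hinv : NoSelfInverse G X Y) {a b c : V} (hs : SameSide X Y a b) (hs' : SameSide X Y b c)
    (hab : IsNontrivial G (a, b)) (hbc : IsNontrivial G (b, c)) (hca : IsNontrivial G (c, a))
    (dab : LexOriented ix G X a b) (dbc : LexOriented ix G X b c) :
    ¬ LexOriented ix G X c a := by
  intro dca
  rcases hs with ⟨ha, hb⟩ | ⟨ha, hb⟩
  · have hc : c ∈ X := hs'.elim And.right fun h => (hG.not_mem_right hb h.1).elim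
    exact not_cyclic_of_mem hix hG hinv ha hb hc hab hbc hca dab dbc dca
  have hc : c ∈ Y := hs'.elim (fun h => (hG.not_mem_right h.1 hb).elim) And.right
  have asymm : ∀ {x y : V}, x ∈ Y → y ∈ Y → IsNontrivial G (x, y) → LexOriented ix G X x y →
      ¬ LexOriented ix G X y x := by
    rintro x y hx hy ⟨_, hxy⟩ h
    exact h.asymm hix hG (.inr ⟨hx, hy⟩) (hinv _ _ hxy.fst_ne_snd (.inr ⟨hx, hy⟩))
  have h₁ : ¬ SameClass G (b, a) (b, c) := fun k => asymm ha hb hab dab (dbc.congr k.symm)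
  have h₂ : ¬ SameClass G (a, c) (b, c) := fun k => asymm hc ha hca dca (dbc.congr k.symm)
  obtain ⟨⟨β, γ⟩, hq⟩ := id hbc
  obtain ⟨α, hα⟩ := exists_matching_or_hexagon hab h₁ h₂ hq
  obtain ⟨hbβ, hcγ, hbγ, hcβ⟩ := id hq
  have hβ := hG.mem_left hbβ hb
  have hγ := hG.mem_left hcγ hc
  obtain ⟨f₁, f₂⟩ | f : (Forces G (a, b) (α, β) ∧ Forces G (c, a) (γ, α)) ∨
      (Forces G (c, a) (α, β) ∧ Forces G (a, b) (γ, α)) := by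
    rcases hα with ⟨haα, hbα, hcα, haβ, haγ⟩ | ⟨haα, hbα, hcα, haβ, haγ⟩
    · exact .inl ⟨⟨haα, hbβ, haβ, hbα⟩, ⟨hcγ, haα, hcα, haγ⟩⟩
    · exact .inr ⟨⟨hcα, haβ, hcβ, haα⟩, ⟨haγ, hbα, haα, hbγ⟩⟩
  · exact not_cyclic_of_mem hix hG hinv (hG.mem_left f₁.1 ha) hβ hγ ⟨_, f₁.symm⟩ ⟨_, hq.symm⟩
      ⟨_, f₂.symm⟩ (dab.congr (.of_forces f₁)) (dbc.congr (.of_forces hq))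
      (dca.congr (.of_forces f₂))
  · exact not_cyclic_of_mem hix hG hinv (hG.mem_left f.1.1 hc) hβ hγ ⟨_, f.1.symm⟩ ⟨_, hq.symm⟩
      ⟨_, f.2.symm⟩ (dca.congr (.of_forces f.1)) (dbc.congr (.of_forces hq))
      (dab.congr (.of_forces f.2))

/-! ### The resulting linear orders -/

/-- The lexicographic orientation, extended to the pairs with comparable neighbourhoods by
inclusion and, for equal neighbourhoods, by the index. -/
def LexOrder (ix : V → ℕ) (G : SimpleGraph V) (X : Set V) (a b : V) : Prop :=
  (IsNontrivial G (a, b) ∧ LexOriented ix G X a b) ∨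
  (¬ IsNontrivial G (a, b) ∧ (∀ c, G.Adj a c → G.Adj b c) ∧
    ((∀ c, G.Adj b c → G.Adj a c) → ix a < ix b))

theorem not_isNontrivial_iff {a b : V} : ¬ IsNontrivial G (a, b) ↔
    (∀ c, G.Adj a c → G.Adj b c) ∨ (∀ c, G.Adj b c → G.Adj a c) := by
  constructor
  · intro h
    by_contra! k
    obtain ⟨⟨c, hc, hc'⟩, d, hd, hd'⟩ := k
    exact h ⟨(c, d), hc, hd, hd', hc'⟩
  · rintro (h | h) ⟨q, h₁, h₂, h₃, h₄⟩
    · exact h₄ (h _ h₁)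
    · exact h₃ (h _ h₂)

theorem LexOrder.irrefl (a : V) : ¬ LexOrder ix G X a a := by
  rintro (⟨⟨_, h⟩, -⟩ | ⟨-, -, h⟩)
  · exact h.fst_ne_snd rfl
  · exact lt_irrefl _ (h fun _ h => h)

theorem LexOrder.asymm (hix : Function.Injective ix) (hG : IsBipartition G X Y)
    (hinv : NoSelfInverse G X Y) {a b : V} (hab : SameSide X Y a b)
    (h : LexOrder ix G X a b) : ¬ LexOrder ix G X b a := by
  rcases h with ⟨hn, h⟩ | ⟨hn, h, h'⟩ <;> rintro (⟨hm, k⟩ | ⟨hm, k, k'⟩)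
  · obtain ⟨_, hq⟩ := hn
    exact h.asymm hix hG hab (hinv _ _ hq.fst_ne_snd hab) k
  · exact hm hn.swap
  · exact hn hm.swap
  · exact lt_asymm (h' k) (k' h)

theorem LexOrder.total (hix : Function.Injective ix) (hG : IsBipartition G X Y) {a b : V}
    (hab : SameSide X Y a b) (hne : a ≠ b) : LexOrder ix G X a b ∨ LexOrder ix G X b a := by
  by_cases hn : IsNontrivial G (a, b)
  · exact (LexOriented.total hix hG hab hn).imp (fun h => .inl ⟨hn, h⟩) fun h => .inl ⟨hn.swap, h⟩
  have hn' : ¬ IsNontrivial G (b, a) := fun h => hn h.swap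
  by_cases h₁ : ∀ c, G.Adj a c → G.Adj b c <;> by_cases h₂ : ∀ c, G.Adj b c → G.Adj a c
  · exact (lt_or_gt_of_ne (hix.ne hne)).imp (fun h => .inr ⟨hn, h₁, fun _ => h⟩)
      fun h => .inr ⟨hn', h₂, fun _ => h⟩
  · exact .inl (.inr ⟨hn, h₁, fun h => (h₂ h).elim⟩)
  · exact .inr (.inr ⟨hn', h₂, fun h => (h₁ h).elim⟩)
  · exact ((not_isNontrivial_iff.1 hn).elim h₁ h₂).elim

/-- If the other two pairs are nontrivial, the inclusion of neighbourhoods makes `(c, a)` and `(c,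
b)` force a common pair, contradicting their orientations. Otherwise inclusions compose around the
cycle; if all are equalities, the indices would increase cyclically. -/
theorem LexOrder.not_cyclic_of_trivial (hix : Function.Injective ix) (hG : IsBipartition G X Y)
    (hinv : NoSelfInverse G X Y) {a b c : V} (hbc' : SameSide X Y b c)
    (hn : ¬ IsNontrivial G (a, b)) (hab : LexOrder ix G X a b) (hbc : LexOrder ix G X b c) :
    ¬ LexOrder ix G X c a := by
  intro hca
  obtain ⟨h, -⟩ | ⟨-, hab, hab'⟩ := hab
  · exact hn h
  rcases hbc with ⟨hb, dbc⟩ | ⟨hb, hbc, hbc'⟩ <;> rcases hca with ⟨hc, dca⟩ | ⟨hc, hca, hca'⟩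
  · obtain ⟨⟨γ, α⟩, hcγ, haα, hcα, haγ⟩ := hc
    obtain ⟨⟨_, δ⟩, -, hcδ, hbδ, -⟩ := id hb
    dsimp only at hcγ haα hcα haγ hcδ hbδ
    have haδ : ¬ G.Adj a δ := fun k => hbδ (hab _ k)
    have f : Forces G (c, a) (δ, α) := ⟨hcδ, haα, hcα, haδ⟩
    have f' : Forces G (c, b) (δ, α) := ⟨hcδ, hab _ haα, hcα, hbδ⟩
    exact dbc.asymm hix hG hbc' (hinv _ _ f'.fst_ne_snd.symm hbc')
      (dca.congr ((SameClass.of_forces f).trans (.of_forces f'.symm)))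
  · exact not_isNontrivial_iff.2 (.inr fun d hd => hab _ (hca _ hd)) hb
  · exact not_isNontrivial_iff.2 (.inr fun d hd => hbc _ (hab _ hd)) hc
  · have h₁ := hab' fun d hd => hca _ (hbc _ hd)
    have h₂ := hbc' fun d hd => hab _ (hca _ hd)
    have h₃ := hca' fun d hd => hbc _ (hab _ hd)
    omega

theorem LexOrder.trans (hix : Function.Injective ix) (hG : IsBipartition G X Y)
    (hinv : NoSelfInverse G X Y) {a b c : V} (hs : SameSide X Y a b) (hs' : SameSide X Y b c)
    (hs'' : SameSide X Y c a) (hab : LexOrder ix G X a b) (hbc : LexOrder ix G X b c) :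
    LexOrder ix G X a c := by
  have hne : c ≠ a := by
    rintro rfl
    exact hab.asymm hix hG hinv hs hbc
  refine (LexOrder.total hix hG hs'' hne).resolve_left fun hca => ?_
  by_cases h₁ : IsNontrivial G (a, b)
  swap; · exact not_cyclic_of_trivial hix hG hinv hs' h₁ hab hbc hca
  by_cases h₂ : IsNontrivial G (b, c)
  swap; · exact not_cyclic_of_trivial hix hG hinv hs'' h₂ hbc hca hab
  by_cases h₃ : IsNontrivial G (c, a)
  swap; · exact not_cyclic_of_trivial hix hG hinv hs h₃ hca hab hbc
  exact LexOriented.not_cyclic hix hG hinv hs hs' h₁ h₂ h₃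
    (hab.resolve_right fun h => h.1 h₁).2 (hbc.resolve_right fun h => h.1 h₂).2
    (hca.resolve_right fun h => h.1 h₃).2

theorem LexOrder.isStrictTotalOrder (hix : Function.Injective ix) (hG : IsBipartition G X Y)
    (hinv : NoSelfInverse G X Y) {Z : Set V} (hZ : ∀ a ∈ Z, ∀ b ∈ Z, SameSide X Y a b) :
    IsStrictTotalOrder Z fun a b => LexOrder ix G X a b where
  trichotomous a b h h' := by
    by_contra hne
    exact (LexOrder.total hix hG (hZ _ a.2 _ b.2) (Subtype.coe_ne_coe.2 hne)).elim h h'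
  irrefl a := LexOrder.irrefl _
  trans a b c := LexOrder.trans hix hG hinv (hZ _ a.2 _ b.2) (hZ _ b.2 _ c.2) (hZ _ c.2 _ a.2)

end Lex

theorem isCocomparabilityBigraph_of_noSelfInverse [Countable V] (hG : IsBipartition G X Y)
    (hinv : NoSelfInverse G X Y) : IsCocomparabilityBigraph G X Y := by
  obtain ⟨ix, hix⟩ := exists_injective_nat V
  refine ⟨_, _, LexOrder.isStrictTotalOrder (ix := ix) hix hG hinv
    fun a ha b hb => .inl ⟨ha, hb⟩, LexOrder.isStrictTotalOrder (ix := ix) hix hG hinv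
    fun a ha b hb => .inr ⟨ha, hb⟩, fun u v w z huv hwz huz hvw => ?_⟩
  by_contra! k
  -- A violation of S-freeness is a forcing step, along which the orientation is constant; so `z`
  -- precedes `w`.
  have f : Forces G (u, v) (z, w) := ⟨huz, hvw, k.1, k.2⟩
  have hs : SameSide X Y (w : V) z := .inr ⟨w.2, z.2⟩
  have h₁ : LexOrder ix G X z w := by
    refine .inl ⟨⟨_, f.symm⟩, LexOriented.congr ?_ (.of_forces f)⟩
    exact (huv.resolve_right fun h => h.1 ⟨_, f⟩).2
  exact hwz.asymm hix hG hinv hs h₁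

/-! ### The splitting of a graph by the components of the complement in neighbourhoods -/

section Split

variable {U : Type*} {H : SimpleGraph U}

/-- `x` and `y` are joined in the complement of `H` by a path inside the neighbourhood of `v`. -/
def Link (H : SimpleGraph U) (v : U) : U → U → Prop :=
  Relation.ReflTransGen fun x y => H.Adj v x ∧ H.Adj v y ∧ ¬ H.Adj x y

theorem Link.symm {v x y : U} (h : Link H v x y) : Link H v y x := by
  induction h with
  | refl => exact .refl
  | tail _ h ih => exact .head ⟨h.2.1, h.1, fun k => h.2.2 k.symm⟩ ih

theorem Link.trans {v x y z : U} (h : Link H v x y) (h' : Link H v y z) : Link H v x z :=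
  Relation.ReflTransGen.trans h h'

theorem Link.adj {v x y : U} (h : Link H v x y) (hx : H.Adj v x) : H.Adj v y := by
  induction h with
  | refl => exact hx
  | tail _ h _ => exact h.2.1

theorem link_of_not_adj {v x y : U} (hx : H.Adj v x) (hy : H.Adj v y) (h : ¬ H.Adj x y) :
    Link H v x y :=
  .single ⟨hx, hy, h⟩

/-- A link transfers to every vertex adjacent to all the vertices linked to its ends. -/
theorem Link.transfer {v w x y : U} (h : Link H v x y) (hw : ∀ z, Link H v x z → H.Adj w z) :
    Link H w x y := by
  have : ∀ z, Link H v x z → Link H w x z := by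
    intro z hz
    induction hz with
    | refl => exact .refl
    | @tail z z' hz h ih => exact ih.tail ⟨hw _ hz, hw _ (hz.tail h), h.2.2⟩
  exact this y h

/-- The copy of the vertex `x` that is used by its edge to `y`. -/
def node (H : SimpleGraph U) (x y : U) : U × Set U := (x, {z | Link H x y z})

theorem node_eq_of_link {x y z : U} (h : Link H x y z) : node H x y = node H x z :=
  Prod.ext rfl (Set.ext fun _ => ⟨fun k => h.symm.trans k, fun k => h.trans k⟩)

theorem link_of_node_eq {x y z : U} (h : node H x y = node H x z) : Link H x y z := by
  have : z ∈ (node H x z).2 := Relation.ReflTransGen.refl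
  rw [← h] at this
  exact this

/-- The graph obtained from `H` by splitting every vertex `v` into one copy for each component of
the complement of `H` in the neighbourhood of `v`. -/
def splitGraph (H : SimpleGraph U) : SimpleGraph (U × Set U) where
  Adj m n := H.Adj m.1 n.1 ∧ m = node H m.1 n.1 ∧ n = node H n.1 m.1
  symm := ⟨fun _ _ h => ⟨h.1.symm, h.2.2, h.2.1⟩⟩
  loopless := ⟨fun _ h => h.1.ne rfl⟩

theorem splitGraph_adj {x y : U} (h : H.Adj x y) :
    (splitGraph H).Adj (node H x y) (node H y x) := ⟨h, rfl, rfl⟩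

/-- There is a walk of length `n` from `u` to `v`. -/
def HasWalk {N : Type*} (K : SimpleGraph N) (n : ℕ) (u v : N) : Prop :=
  ∃ w : K.Walk u v, w.length = n

namespace HasWalk

variable {N : Type*} {K : SimpleGraph N} {u v w : N} {m n : ℕ}

theorem trans (h : HasWalk K m u v) (h' : HasWalk K n v w) : HasWalk K (m + n) u w := by
  obtain ⟨p, rfl⟩ := h
  obtain ⟨q, rfl⟩ := h'
  exact ⟨p.append q, p.length_append q⟩

theorem symm (h : HasWalk K m u v) : HasWalk K m v u := by
  obtain ⟨p, rfl⟩ := h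
  exact ⟨p.reverse, p.length_reverse⟩

theorem of_adj (h : K.Adj u v) : HasWalk K 1 u v := ⟨.cons h .nil, rfl⟩

theorem getVert (p : K.Walk u v) {i j : ℕ} (hij : i ≤ j) (hj : j ≤ p.length) :
    HasWalk K (j - i) (p.getVert i) (p.getVert j) := by
  refine ⟨((p.drop i).take (j - i)).copy rfl ?_, ?_⟩
  · rw [SimpleGraph.Walk.drop_getVert]
    congr 1
    omega
  · simp
    omega

end HasWalk

/-! ### Shortest odd closed walks in the split graph -/

/-- Every odd closed walk of `K` has length at least `L`. -/
def OddGirthGE {N : Type*} (K : SimpleGraph N) (L : ℕ) : Prop :=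
  ∀ n v, Odd n → HasWalk K n v v → L ≤ n

variable {T S : U × Set U}

/-- A vertex `y` of the component `S.2` sees the first two vertices of the walk. It keeps seeing the
later ones until it is linked to `v (i - 1)` around `v i`, and its copy towards `v k` depends only
on the parity of `k`. This must stop, since the last but one vertex lies in `S.2` and does not see
itself; at the stop, the edge from `y` to `v i` ends in the copy `p.getVert i`. -/
theorem exists_merge (hTS : T.1 = S.1) (hne : T ≠ S) (p : (splitGraph H).Walk T S) :
    ∃ i, 1 ≤ i ∧ i + 2 ≤ p.length ∧ ∀ y ∈ S.2, H.Adj y (p.getVert i).1 ∧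
      (splitGraph H).Adj (p.getVert i)
        (node H y (p.getVert (if Even i then 0 else 1)).1) := by
  classical
  set v : ℕ → U := fun k => (p.getVert k).1 with hv
  have hlen : 0 < p.length := by
    rcases Nat.eq_zero_or_pos p.length with h | h
    · exact (hne (SimpleGraph.Walk.eq_of_length_eq_zero h)).elim
    · exact h
  have hadj (k : ℕ) (hk : k < p.length) : (splitGraph H).Adj (p.getVert k) (p.getVert (k + 1)) :=
    p.adj_getVert_succ hk
  have h0 : p.getVert 0 = T := p.getVert_zero
  have hr : p.getVert p.length = S := p.getVert_length
  obtain ⟨r, hrl⟩ : ∃ r, p.length = r + 1 := ⟨p.length - 1, by omega⟩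
  have hS : S = node H T.1 (v r) := by
    have := (hadj r (by omega)).2.2
    rwa [← hrl, hr, ← hTS] at this
  have hvr : v r ∈ S.2 := by
    rw [hS]
    exact Relation.ReflTransGen.refl
  have hSadj : ∀ y ∈ S.2, H.Adj T.1 y := by
    intro y hy
    have h1 := (hadj r (by omega)).1
    rw [← hrl, hr, ← hTS] at h1
    rw [hS] at hy
    exact Link.adj hy h1.symm
  have hlink (k : ℕ) (hk : k + 1 < p.length) : Link H (v (k + 1)) (v k) (v (k + 2)) :=
    link_of_node_eq ((hadj k (by omega)).2.2.symm.trans (hadj (k + 1) hk).2.1)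
  have hstep (k : ℕ) (hk : k + 1 < p.length)
      (hsep : ∀ y ∈ S.2, ¬ Link H (v (k + 1)) (v k) y) (y : U) (hy : y ∈ S.2)
      (hyv : H.Adj y (v (k + 1))) :
      H.Adj y (v (k + 2)) ∧ node H y (v k) = node H y (v (k + 2)) := by
    -- Vertices in different components of the complement of a neighbourhood are adjacent.
    have hall : ∀ z, Link H (v (k + 1)) (v k) z → H.Adj y z := by
      intro z hz
      by_contra hn
      refine hsep y hy (hz.trans (link_of_not_adj ?_ hyv.symm fun h => hn h.symm))
      exact hz.adj (hadj k (by omega)).1.symm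
    exact ⟨hall _ (hlink k hk), node_eq_of_link ((hlink k hk).transfer hall)⟩
  have hstart : ∀ y ∈ S.2, H.Adj y (v 0) ∧ H.Adj y (v 1) := by
    intro y hy
    have h01 := hadj 0 hlen
    rw [h0] at h01
    refine ⟨?_, ?_⟩
    · simp only [hv, h0]
      exact (hSadj y hy).symm
    · by_contra hn
      refine hne (h01.2.1.trans (.trans (node_eq_of_link ?_) hS.symm))
      have : Link H T.1 (v r) y := by rwa [hS] at hy
      exact (link_of_not_adj h01.1 (hSadj y hy) fun h => hn h.symm).trans this.symm
  let base (k : ℕ) : U := v (if Even k then 0 else 1)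
  have hbase (k : ℕ) : base (k + 2) = base k := by simp [base, Nat.even_add]
  have hinv : ∀ k, k < p.length →
      (∀ j, 1 ≤ j → j ≤ k → ∀ y ∈ S.2, ¬ Link H (v j) (v (j - 1)) y) → ∀ y ∈ S.2,
      (H.Adj y (v k) ∧ node H y (v k) = node H y (base k)) ∧
      (H.Adj y (v (k + 1)) ∧ node H y (v (k + 1)) = node H y (base (k + 1))) := by
    intro k
    induction k with
    | zero => exact fun _ _ y hy => ⟨⟨(hstart y hy).1, by simp [base]⟩,
        (hstart y hy).2, by simp [base]⟩
    | succ k ih =>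
      intro hk hsep y hy
      obtain ⟨⟨-, h₁⟩, h₂⟩ := ih (by omega) (fun j hj hjk => hsep j hj (by omega)) y hy
      obtain ⟨h₃, h₄⟩ := hstep k hk (hsep (k + 1) (by omega) le_rfl) y hy h₂.1
      exact ⟨h₂, h₃, by rw [hbase, ← h₁, h₄]⟩
  have hex : ∃ i, 1 ≤ i ∧ i + 2 ≤ p.length ∧ ∃ y ∈ S.2, Link H (v i) (v (i - 1)) y := by
    by_contra! hno
    rcases Nat.eq_zero_or_pos r with h | h
    · exact (hstart _ hvr).1.ne (by rw [h])
    · have := (hinv (r - 1) (by omega) (fun j h₁ h₂ => hno j h₁ (by omega)) _ hvr).2.1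
      rw [Nat.sub_add_cancel h] at this
      exact this.ne rfl
  obtain ⟨hi₁, hi₂, y₀, hy₀, hl⟩ := Nat.find_spec hex
  set i := Nat.find hex
  have hmin : ∀ j, 1 ≤ j → j ≤ i - 1 → ∀ y ∈ S.2, ¬ Link H (v j) (v (j - 1)) y :=
    fun j h₁ h₂ y hy h => Nat.find_min hex (m := j) (by omega) ⟨h₁, by omega, y, hy, h⟩
  have hi := hinv (i - 1) (by omega) hmin
  rw [Nat.sub_add_cancel hi₁] at hi
  refine ⟨i, hi₁, hi₂, fun y hy => ⟨(hi y hy).2.1, ?_⟩⟩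
  -- All of `S.2` sees `v i`, so one member linked there brings the whole component with it.
  have hl' : Link H (v i) y₀ y := by
    have h : Link H T.1 y₀ y := by
      rw [hS] at hy hy₀
      exact Link.trans (Link.symm hy₀) hy
    refine h.transfer fun z hz => (hi z ?_).2.1.symm
    rw [hS] at hy₀ ⊢
    exact Link.trans hy₀ hz
  have hnode := (hadj (i - 1) (by omega)).2.2
  rw [Nat.sub_add_cancel hi₁] at hnode
  have e : (splitGraph H).Adj (node H (v i) y) (node H y (v i)) :=
    splitGraph_adj (hi y hy).2.1.symm
  rwa [← node_eq_of_link (hl.trans hl'), ← hnode, (hi y hy).2.2] at e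

theorem cross_link (hTS : T.1 = S.1) (hne : T ≠ S) {x₀ y₀ x x' y : U}
    (hx₀ : H.Adj T.1 x₀) (hT : T = node H T.1 x₀) (hy₀ : H.Adj S.1 y₀) (hS : S = node H S.1 y₀)
    (hx : x ∈ T.2) (hx' : x' ∈ T.2) (hy : y ∈ S.2) : H.Adj y x ∧ node H y x = node H y x' := by
  rw [hT] at hx hx'
  rw [hS, ← hTS] at hy
  have hall : ∀ z, Link H T.1 x z → H.Adj y z := by
    intro z hz
    by_contra hn
    have hxz := Link.trans hx hz
    refine hne (hT.trans (.trans ?_ hS.symm))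
    rw [← hTS]
    exact node_eq_of_link (hxz.trans ((link_of_not_adj (hxz.adj hx₀)
      (Link.adj hy (hTS ▸ hy₀)) fun h => hn h.symm).trans (Link.symm hy)))
  exact ⟨hall x .refl, node_eq_of_link ((Link.trans (Link.symm hx) hx').transfer hall)⟩

theorem exists_node_of_walk {N : U × Set U} (hne : T ≠ N) (p : (splitGraph H).Walk T N) :
    H.Adj T.1 (p.getVert 1).1 ∧ T = node H T.1 (p.getVert 1).1 ∧
      p.getVert 1 = node H (p.getVert 1).1 T.1 ∧ (p.getVert 1).1 ∈ T.2 := by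
  have hlen : 0 < p.length := by
    rcases Nat.eq_zero_or_pos p.length with h | h
    · exact (hne (SimpleGraph.Walk.eq_of_length_eq_zero h)).elim
    · exact h
  have h := p.adj_getVert_succ hlen
  rw [p.getVert_zero] at h
  refine ⟨h.1, h.2.1, h.2.2, ?_⟩
  have : (p.getVert 1).1 ∈ (node H T.1 (p.getVert 1).1).2 := Relation.ReflTransGen.refl
  rwa [← h.2.1] at this

/-- Merging points of `p` and of the reverse of `q` create shortcuts. If either index is even, there
is a shorter odd closed walk. If both are odd, the detour through the edge between `node H y x` and
`node H x y` has length `i + 3 + (q.length - t)`, and `i + 2 ≤ p.length` leaves only `t = 1`. -/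
theorem merge_at_one (hTS : T.1 = S.1) (hne : T ≠ S) (p q : (splitGraph H).Walk T S)
    (hp : Odd p.length) (hq : Even q.length)
    (hL : OddGirthGE (splitGraph H) (p.length + q.length)) {x y : U} (hx : x ∈ T.2)
    (hy : y ∈ S.2) : (splitGraph H).Adj (q.reverse.getVert 1) (node H x y) := by
  obtain ⟨i, hi₁, hi₂, hi⟩ := exists_merge hTS hne p
  obtain ⟨t, ht₁, ht₂, ht⟩ := exists_merge hTS.symm hne.symm q.reverse
  obtain ⟨-, -, hp₁, hpT⟩ := exists_node_of_walk hne p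
  obtain ⟨hx₀, hT, -, -⟩ := exists_node_of_walk hne q
  obtain ⟨-, -, hp₂, hpS⟩ := exists_node_of_walk hne.symm p.reverse
  obtain ⟨hy₀, hS, -, hqS⟩ := exists_node_of_walk hne.symm q.reverse
  rw [SimpleGraph.Walk.length_reverse] at ht₂
  have hi_odd : ¬ Even i := by
    intro he
    have h := (hi _ hpS).2
    rw [if_pos he, p.getVert_zero, hTS, ← hp₂, SimpleGraph.Walk.getVert_reverse] at h
    have := hL _ _ ?_ ((HasWalk.getVert p (i := i) (j := p.length - 1) (by omega)
      (by omega)).trans (.of_adj h.symm))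
    · omega
    · rw [← Nat.not_even_iff_odd] at hp ⊢
      grind
  have ht_odd : ¬ Even t := by
    intro he
    have h := (ht _ hpT).2
    rw [if_pos he, SimpleGraph.Walk.getVert_zero, ← hTS, ← hp₁] at h
    have h₁ := HasWalk.getVert p (i := 1) (j := p.length) (by omega) le_rfl
    have h₂ := HasWalk.getVert q.reverse (i := 0) (j := t) (by omega) (by simp; omega)
    rw [p.getVert_length] at h₁
    rw [SimpleGraph.Walk.getVert_zero] at h₂
    have := hL _ _ ?_ ((h₁.trans h₂).trans (.of_adj h))
    · omega
    · rw [← Nat.not_even_iff_odd] at hp ⊢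
      grind
  rw [if_neg hi_odd] at hi
  rw [if_neg ht_odd] at ht
  have ht_one : t = 1 := by
    have h₁ := (hi _ hy).2
    have h₂ := (ht _ hx).2
    rw [(cross_link hTS hne hx₀ hT hy₀ hS hpT hx hy).2] at h₁
    rw [(cross_link hTS.symm hne.symm hy₀ hS hx₀ hT hqS hy hx).2] at h₂
    have h₃ := splitGraph_adj (cross_link hTS hne hx₀ hT hy₀ hS hx hx hy).1
    have h₄ := HasWalk.getVert p (i := 0) (j := i) (by omega) (by omega)
    have h₅ := HasWalk.getVert q.reverse (i := t) (j := q.length) (by omega) (by simp)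
    rw [p.getVert_zero] at h₄
    rw [← q.length_reverse, SimpleGraph.Walk.getVert_length] at h₅
    have := hL _ _ ?_ ((((h₄.trans (.of_adj h₁)).trans (.of_adj h₃)).trans
      (.of_adj h₂.symm)).trans h₅)
    · rw [SimpleGraph.Walk.length_reverse] at this
      clear hi ht
      grind
    · rw [← Nat.not_even_iff_odd] at hp ⊢
      simp only [SimpleGraph.Walk.length_reverse]
      grind
  subst ht_one
  rw [← (cross_link hTS.symm hne.symm hy₀ hS hx₀ hT hqS hy hx).2]
  exact (ht _ hx).2

/-- Applying `merge_at_one` from both ends shows that the second and the last but one node of `q`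
are adjacent. Closing the middle of `q` by this edge gives an odd closed walk of length `q.length -
1`. -/
theorem not_oddGirthGE (hTS : T.1 = S.1) (hne : T ≠ S) (p q : (splitGraph H).Walk T S)
    (hp : Odd p.length) (hq : Even q.length) :
    ¬ OddGirthGE (splitGraph H) (p.length + q.length) := by
  intro hL
  obtain ⟨-, -, -, hqT⟩ := exists_node_of_walk hne q
  obtain ⟨-, -, -, hqS⟩ := exists_node_of_walk hne.symm q.reverse
  have h₁ := merge_at_one hTS hne p q hp hq hL hqT hqS
  have h₂ := merge_at_one hTS.symm hne.symm p.reverse q.reverse (by simpa) (by simpa)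
    (by simpa) hqS hqT
  rw [SimpleGraph.Walk.reverse_reverse] at h₂
  have h : (splitGraph H).Adj (q.getVert 1) (q.reverse.getVert 1) := by
    have e₁ := h₁.2.1
    have e₂ := h₂.2.1
    dsimp only [node] at e₁ e₂
    refine ⟨h₂.1, e₂, e₁⟩
  have hlen : 2 ≤ q.length := by
    rcases Nat.eq_zero_or_pos q.length with h | h
    · exact (hne (SimpleGraph.Walk.eq_of_length_eq_zero h)).elim
    · grind
  rw [SimpleGraph.Walk.getVert_reverse] at h
  have := hL _ _ ?_ ((HasWalk.getVert q (i := 1) (j := q.length - 1) (by omega)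
      (by omega)).trans (.of_adj h.symm))
  · grind
  · rw [← Nat.not_even_iff_odd]
    grind

/-- A cyclic sequence of odd length in `H` of which any three consecutive members `u`, `v`, `w`
are such that `u`, `w` are linked in the neighbourhood of `v`. -/
def IsLinkedCycle (H : SimpleGraph U) (k : ℕ) (f : ZMod (2 * k + 1) → U) : Prop :=
  ∀ j, H.Adj (f j) (f (j + 1)) ∧ Link H (f j) (f (j + 1)) (f (j - 1))

theorem exists_injective_linkedCycle {n : ℕ} {N : U × Set U} (hn : Odd n)
    (h : HasWalk (splitGraph H) n N N) :
    ∃ (k : ℕ) (f : ZMod (2 * k + 1) → U), Function.Injective f ∧ IsLinkedCycle H k f := by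
  classical
  have hex : ∃ n, Odd n ∧ ∃ N, HasWalk (splitGraph H) n N N := ⟨n, hn, N, h⟩
  obtain ⟨hodd, M, w, hw⟩ := Nat.find_spec hex
  have hL : OddGirthGE (splitGraph H) w.length := by
    intro m v hm hv
    rw [hw]
    exact Nat.find_min' hex ⟨hm, v, hv⟩
  rw [← hw] at hodd
  obtain ⟨k, hk⟩ := hodd
  have hinj : ∀ i j, i < j → j < w.length → (w.getVert i).1 ≠ (w.getVert j).1 := by
    intro i j hij hj e
    have h₁ := HasWalk.getVert w hij.le hj.le
    have h₂ := (HasWalk.getVert w hj.le le_rfl)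
    have h₃ := (HasWalk.getVert w (Nat.zero_le i) (hij.le.trans hj.le))
    rw [w.getVert_length] at h₂
    rw [w.getVert_zero] at h₃
    have h₄ := (h₂.trans h₃).symm
    -- A repeated node cuts off a shorter odd closed walk; two copies of one vertex split the walk
    -- into arcs of opposite parity.
    by_cases hne : w.getVert i = w.getVert j
    · rcases Nat.even_or_odd (j - i) with hp | hp
      · rw [hne] at h₄
        have := hL _ _ (by rw [← Nat.not_even_iff_odd]; grind) h₄
        omega
      · rw [hne] at h₁
        have := hL _ _ hp h₁
        omega
    · obtain ⟨p, hp⟩ := h₁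
      obtain ⟨q, hq⟩ := h₄
      have hL' : w.length = p.length + q.length := by omega
      rcases Nat.even_or_odd (j - i) with hpar | hpar
      · refine not_oddGirthGE e hne q p ?_ (hp ▸ hpar) ?_
        · rw [← Nat.not_even_iff_odd]; grind
        · rwa [add_comm, ← hL']
      · refine not_oddGirthGE e hne p q (hp ▸ hpar) ?_ ?_
        · rw [← Nat.not_odd_iff_even]; grind
        · rwa [← hL']
  have hval (j : ZMod (2 * k + 1)) : j.val < w.length := by
    have := j.val_lt
    omega
  have hsucc (j : ZMod (2 * k + 1)) : w.getVert (j + 1).val = w.getVert (j.val + 1) := by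
    have e : (j + 1).val = (j.val + 1) % (2 * k + 1) := by
      rw [ZMod.val_add, ZMod.val_one_eq_one_mod, Nat.add_mod_mod]
    rcases Nat.lt_or_ge (j.val + 1) (2 * k + 1) with h | h
    · rw [e, Nat.mod_eq_of_lt h]
    · have h' : j.val + 1 = w.length := le_antisymm (hval j) (by omega)
      rw [e, h', hk, Nat.mod_self, ← hk, w.getVert_zero, w.getVert_length]
  refine ⟨k, fun j => (w.getVert j.val).1, fun i j hij => ?_, fun j => ?_⟩
  · rcases lt_trichotomy i.val j.val with h | h | h
    · exact (hinj _ _ h (hval j) hij).elim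
    · exact ZMod.val_injective _ h
    · exact (hinj _ _ h (hval i) hij.symm).elim
  · have h₁ := w.adj_getVert_succ (hval j)
    have h₂ := w.adj_getVert_succ (hval (j - 1))
    rw [← hsucc] at h₁ h₂
    rw [sub_add_cancel] at h₂
    exact ⟨h₁.1, link_of_node_eq (h₁.2.1.symm.trans h₂.2.2)⟩

end Split

/-! ### Orientations and orders -/

theorem SameSide.symm {a b : V} (h : SameSide X Y a b) : SameSide X Y b a :=
  Or.imp And.symm And.symm h

theorem SameSide.trans (hG : IsBipartition G X Y) {a b c : V} (h : SameSide X Y a b)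
    (h' : SameSide X Y b c) : SameSide X Y a c := by
  rcases h with h | h <;> rcases h' with h' | h'
  · exact .inl ⟨h.1, h'.2⟩
  · exact (hG.not_mem_right h.2 h'.1).elim
  · exact (hG.not_mem_right h'.1 h.2).elim
  · exact .inr ⟨h.1, h'.2⟩

theorem SameSide.not_adj (hG : IsBipartition G X Y) {a b : V} (h : SameSide X Y a b) :
    ¬ G.Adj a b := by
  intro k
  rcases h with h | h
  · exact hG.not_mem_right h.2 (hG.mem_right k h.1)
  · exact hG.not_mem_right (hG.mem_left k h.1) h.2

theorem SameSide.of_adj (hG : IsBipartition G X Y) {a b c d : V} (h : SameSide X Y a b)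
    (hac : G.Adj a c) (hbd : G.Adj b d) : SameSide X Y c d :=
  h.elim (fun h => .inr ⟨hG.mem_right hac h.1, hG.mem_right hbd h.2⟩)
    fun h => .inl ⟨hG.mem_left hac h.1, hG.mem_left hbd h.2⟩

theorem Forces.independent (hG : IsBipartition G X Y) {a b c d : V} (hs : SameSide X Y a b)
    (h : Forces G (a, b) (c, d)) : Independent G s(a, c) s(b, d) := by
  obtain ⟨hac, hbd, had, hbc⟩ := id h
  have hs' := hs.of_adj hG hac hbd
  dsimp only at hac hbd had hbc
  intro u hu v hv
  rw [Sym2.mem_iff] at hu hv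
  rcases hu with rfl | rfl <;> rcases hv with rfl | rfl
  · exact ⟨h.fst_ne_snd, hs.not_adj hG⟩
  · exact ⟨fun e => hs.not_adj hG (e ▸ hbd.symm), had⟩
  · exact ⟨fun e => hs.not_adj hG (e ▸ hac), fun k => hbc k.symm⟩
  · exact ⟨h.symm.fst_ne_snd, hs'.not_adj hG⟩

theorem Independent.forces {a b c d : V} (h : Independent G s(a, c) s(b, d)) (hac : G.Adj a c)
    (hbd : G.Adj b d) : Forces G (a, b) (c, d) :=
  ⟨hac, hbd, (h a (by simp) d (by simp)).2, fun k => (h c (by simp) b (by simp)).2 k.symm⟩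

theorem bipartiteCompl_adj (hG : IsBipartition G X Y) {x y : V} (hx : x ∈ X) (hy : y ∈ Y) :
    (bipartiteCompl G X Y).Adj x y ↔ ¬ G.Adj x y := by
  rw [bipartiteCompl, SimpleGraph.fromRel_adj]
  constructor
  · rintro ⟨-, h | h⟩
    · exact h.2.2
    · exact (hG.not_mem_right hx h.2.1).elim
  · exact fun h => ⟨fun e => hG.not_mem_right hx (e ▸ hy), .inl ⟨hx, hy, h⟩⟩

theorem isBipartition_bipartiteCompl (hG : IsBipartition G X Y) :
    IsBipartition (bipartiteCompl G X Y) X Y where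
  cover := hG.cover
  bipartite :=
    { disjoint := hG.bipartite.disjoint
      mem_of_adj := by
        intro a b h
        rw [bipartiteCompl, SimpleGraph.fromRel_adj] at h
        exact h.2.imp (fun h => ⟨h.1, h.2.1⟩) fun h => ⟨h.2.1, h.1⟩ }

/-- Independent edges of the bipartite complement correspond to crossing independent edges. -/
theorem forces_bipartiteCompl (hG : IsBipartition G X Y) {x x' y y' : V} (hx : x ∈ X)
    (hx' : x' ∈ X) (hy : y ∈ Y) (hy' : y' ∈ Y) :
    Forces (bipartiteCompl G X Y) (x, x') (y, y') ↔ Forces G (x, x') (y', y) := by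
  simp only [Forces, bipartiteCompl_adj hG hx hy, bipartiteCompl_adj hG hx' hy',
    bipartiteCompl_adj hG hx hy', bipartiteCompl_adj hG hx' hy, not_not]
  tauto

theorem tFree_iff (hG : IsBipartition G X Y) {D : V → V → Prop} :
    TFree G X Y D ↔ ∀ x ∈ X, ∀ x' ∈ X, ∀ y ∈ Y, ∀ y' ∈ Y, Forces G (x, x') (y', y) →
      ¬ ((D x x' ∧ D y y') ∨ (D x' x ∧ D y' y)) := by
  constructor
  · intro h x hx x' hx' y hy y' hy' hf
    have hf' := (forces_bipartiteCompl hG hx hx' hy hy').2 hf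
    exact h x hx x' hx' y hy y' hy' hf'.1 hf'.2.1
      (hf'.independent (isBipartition_bipartiteCompl hG) (.inl ⟨hx, hx'⟩))
  · intro h x hx x' hx' y hy y' hy' h₁ h₂ hi
    exact h x hx x' hx' y hy y' hy' ((forces_bipartiteCompl hG hx hx' hy hy').1 (hi.forces h₁ h₂))

/-- T-freeness forbids `c`, `d` from being oriented against a pair `a`, `b` that forces them, and
one of the two directions must occur. -/
theorem TFree.of_forces (hG : IsBipartition G X Y) {D : V → V → Prop} (hD : IsOrientation X Y D)
    (hT : TFree G X Y D) {a b c d : V} (h : Forces G (a, b) (c, d)) (hab : D a b) : D c d := by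
  rw [tFree_iff hG] at hT
  have hs := (hD.within a b hab).2
  have hs' := hs.of_adj hG h.1 h.2.1
  have hx := hD.oriented c d h.symm.fst_ne_snd hs'
  by_contra hcd
  have hdc : D d c := by simpa [Xor, hcd] using hx
  rcases hs with hs | hs
  · exact hT a hs.1 b hs.2 d (hG.mem_right h.2.1 hs.2) c (hG.mem_right h.1 hs.1) h
      (.inl ⟨hab, hdc⟩)
  · exact hT c (hG.mem_left h.1 hs.1) d (hG.mem_left h.2.1 hs.2) b hs.2 a hs.1 h.symm
      (.inr ⟨hdc, hab⟩)

/-- The union of relations on the two classes. -/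
def unionRel (rX : X → X → Prop) (rY : Y → Y → Prop) (a b : V) : Prop :=
  (∃ u v : X, u = a ∧ v = b ∧ rX u v) ∨ ∃ u v : Y, u = a ∧ v = b ∧ rY u v

theorem exists_acyclic_tFree (hG : IsBipartition G X Y) (h : IsCocomparabilityBigraph G X Y) :
    ∃ D : V → V → Prop, IsOrientation X Y D ∧ Acyclic D ∧ TFree G X Y D := by
  obtain ⟨rX, rY, hX, hY, hS⟩ := h
  have eX (a b : V) (ha : a ∈ X) (hb : b ∈ X) : unionRel rX rY a b ↔ rX ⟨a, ha⟩ ⟨b, hb⟩ := by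
    constructor
    · rintro (⟨u, v, rfl, rfl, h⟩ | ⟨u, v, rfl, rfl, h⟩)
      · exact h
      · exact (hG.not_mem_right ha u.2).elim
    · exact fun h => .inl ⟨_, _, rfl, rfl, h⟩
  have eY (a b : V) (ha : a ∈ Y) (hb : b ∈ Y) : unionRel rX rY a b ↔ rY ⟨a, ha⟩ ⟨b, hb⟩ := by
    constructor
    · rintro (⟨u, v, rfl, rfl, h⟩ | ⟨u, v, rfl, rfl, h⟩)
      · exact (hG.not_mem_right u.2 ha).elim
      · exact h
    · exact fun h => .inr ⟨_, _, rfl, rfl, h⟩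
  have within (a b : V) (h : unionRel rX rY a b) : a ≠ b ∧ SameSide X Y a b := by
    rcases h with ⟨u, v, rfl, rfl, h⟩ | ⟨u, v, rfl, rfl, h⟩
    · exact ⟨fun e => irrefl (r := rX) v (Subtype.ext e ▸ h), .inl ⟨u.2, v.2⟩⟩
    · exact ⟨fun e => irrefl (r := rY) v (Subtype.ext e ▸ h), .inr ⟨u.2, v.2⟩⟩
  have trans (a b c : V) (h : unionRel rX rY a b) (h' : unionRel rX rY b c) :
      unionRel rX rY a c := by
    have hs := (within _ _ h).2.trans hG (within _ _ h').2
    rcases (within _ _ h).2 with k | k <;> rcases hs with hs | hs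
    · rw [eX _ _ hs.1 k.2] at h
      rw [eX _ _ k.2 hs.2] at h'
      exact (eX _ _ hs.1 hs.2).2 (_root_.trans h h')
    · exact (hG.not_mem_right k.1 hs.1).elim
    · exact (hG.not_mem_right hs.1 k.1).elim
    · rw [eY _ _ hs.1 k.2] at h
      rw [eY _ _ k.2 hs.2] at h'
      exact (eY _ _ hs.1 hs.2).2 (_root_.trans h h')
  have total (a b : V) (hne : a ≠ b) (hs : SameSide X Y a b) :
      unionRel rX rY a b ∨ unionRel rX rY b a := by
    rcases hs with hs | hs
    · rw [eX _ _ hs.1 hs.2, eX _ _ hs.2 hs.1]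
      rcases trichotomous_of rX ⟨a, hs.1⟩ ⟨b, hs.2⟩ with h | h | h
      · exact .inl h
      · exact (hne (congrArg Subtype.val h)).elim
      · exact .inr h
    · rw [eY _ _ hs.1 hs.2, eY _ _ hs.2 hs.1]
      rcases trichotomous_of rY ⟨a, hs.1⟩ ⟨b, hs.2⟩ with h | h | h
      · exact .inl h
      · exact (hne (congrArg Subtype.val h)).elim
      · exact .inr h
  refine ⟨unionRel rX rY, ⟨within, fun a b hne hs => ?_⟩, fun a ha => ?_, ?_⟩
  · rcases total a b hne hs with h | h
    · exact .inl ⟨h, fun k => (within _ _ (trans _ _ _ h k)).1 rfl⟩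
    · exact .inr ⟨h, fun k => (within _ _ (trans _ _ _ h k)).1 rfl⟩
  · have : ∀ b, Relation.TransGen (unionRel rX rY) a b → unionRel rX rY a b := by
      intro b hb
      induction hb with
      | single h => exact h
      | tail _ h ih => exact trans _ _ _ ih h
    exact (within _ _ (this a ha)).1 rfl
  · rw [tFree_iff hG]
    rintro x hx x' hx' y hy y' hy' ⟨h₁, h₂, h₃, h₄⟩ (⟨k, k'⟩ | ⟨k, k'⟩)
    · rw [eX _ _ hx hx'] at k
      rw [eY _ _ hy hy'] at k'
      exact (hS _ _ _ _ k k' h₁ h₂).elim h₃ h₄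
    · rw [eX _ _ hx' hx] at k
      rw [eY _ _ hy' hy] at k'
      exact (hS _ _ _ _ k k' h₂ h₁).elim h₄ h₃

/-! ### Invertible pairs -/

theorem sameClass_of_walks {a b c d : V} (W : G.Walk a b) (W' : G.Walk c d)
    (h : List.Forall₂ (Independent G) W.edges W'.edges) : SameClass G (a, c) (b, d) := by
  induction W generalizing c d with
  | nil =>
    cases W' with
    | nil => exact .refl _
    | cons => simp at h
  | cons hadj W ih =>
    cases W' with
    | nil => simp at h
    | cons hadj' W' =>
      simp only [SimpleGraph.Walk.edges_cons, List.forall₂_cons] at h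
      exact .trans (.of_forces (h.1.forces hadj hadj')) (ih W' h.2)

theorem SameClass.exists_walks (hG : IsBipartition G X Y) {p q : V × V} (h : SameClass G p q)
    (hs : SameSide X Y p.1 p.2) : ∃ (W : G.Walk p.1 q.1) (W' : G.Walk p.2 q.2),
      List.Forall₂ (Independent G) W.edges W'.edges := by
  induction h using Relation.ReflTransGen.head_induction_on with
  | refl => exact ⟨.nil, .nil, .nil⟩
  | head h _ ih =>
    obtain ⟨W, W', hW⟩ := ih (hs.of_adj hG h.1 h.2.1)
    refine ⟨.cons h.1 W, .cons h.2.1 W', ?_⟩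
    simp only [SimpleGraph.Walk.edges_cons, List.forall₂_cons]
    exact ⟨h.independent hG hs, hW⟩

theorem noSelfInverse_iff (hG : IsBipartition G X Y) :
    NoSelfInverse G X Y ↔ ¬ ∃ u v : V, IsInvertiblePair G X Y u v := by
  constructor
  · rintro h ⟨u, v, hne, W, W', hs, hW⟩
    exact h u v hne hs (sameClass_of_walks W W' hW)
  · intro h u v hne hs k
    obtain ⟨W, W', hW⟩ := k.exists_walks hG hs
    exact h ⟨u, v, hne, W, W', hs, hW⟩

theorem noSelfInverse_of_tFree (hG : IsBipartition G X Y) {D : V → V → Prop}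
    (hD : IsOrientation X Y D) (hT : TFree G X Y D) : NoSelfInverse G X Y := by
  intro a b hne hs h
  have key : ∀ p q : V × V, SameClass G p q → D p.1 p.2 → D q.1 q.2 := by
    intro p q hpq hp
    induction hpq with
    | refl => exact hp
    | tail _ h ih => exact hT.of_forces hG hD h ih
  rcases hD.oriented a b hne hs with ⟨h₁, h₂⟩ | ⟨h₁, h₂⟩
  · exact h₂ (key _ _ h h₁)
  · exact h₂ (key _ _ h.swap h₁)

/-! ### The independence graph -/

theorem exists_eq_mk (hG : IsBipartition G X Y) (e : G.edgeSet) :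
    ∃ x ∈ X, ∃ y ∈ Y, G.Adj x y ∧ (e : Sym2 V) = s(x, y) := by
  obtain ⟨e, he⟩ := e
  induction e using Sym2.ind with
  | _ a b =>
    have h : G.Adj a b := he
    rcases hG.mem_or a with ha | ha
    · exact ⟨a, ha, b, hG.mem_right h ha, h, rfl⟩
    · exact ⟨b, hG.mem_left h ha, a, ha, h.symm, Sym2.eq_swap⟩

theorem eq_of_mk_eq (hG : IsBipartition G X Y) {x y x' y' : V} (hx : x ∈ X) (hx' : x' ∈ X)
    (hxy : G.Adj x y) (h : s(x, y) = s(x', y')) : x = x' ∧ y = y' := by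
  rcases Sym2.eq_iff.1 h with h | h
  · exact h
  · exact (hG.not_mem_right hx' (h.2 ▸ hG.mem_right hxy hx)).elim

/-- Independent edges are directed by their ends in `X`; closure under forcing directs their ends in
`Y` alike. -/
theorem isComparabilityGraph_independenceGraph (hG : IsBipartition G X Y) {D : V → V → Prop}
    (hD : IsOrientation X Y D) (hA : Acyclic D) (hT : TFree G X Y D) :
    IsComparabilityGraph (independenceGraph G) := by
  have asymm (a b : V) (h : D a b) (h' : D b a) : False := hA a (.tail (.single h) h')
  refine ⟨fun e f => ∃ x ∈ X, ∃ x' ∈ X, ∃ y y', (e : Sym2 V) = s(x, y) ∧ (f : Sym2 V) = s(x', y') ∧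
    Forces G (x, x') (y, y') ∧ D x x', fun e f => ⟨fun h => ?_, ?_⟩, ?_, ?_⟩
  · obtain ⟨x, hx, y, -, hxy, he⟩ := exists_eq_mk hG e
    obtain ⟨x', hx', y', -, hxy', hf⟩ := exists_eq_mk hG f
    have h' : Independent G e f := h
    rw [he, hf] at h'
    have hF := h'.forces hxy hxy'
    rcases hD.oriented x x' hF.fst_ne_snd (.inl ⟨hx, hx'⟩) with k | k
    · exact .inl ⟨x, hx, x', hx', y, y', he, hf, hF, k.1⟩
    · exact .inr ⟨x', hx', x, hx, y', y, hf, he, hF.swap, k.1⟩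
  · rintro (⟨x, hx, x', hx', y, y', he, hf, hF, -⟩ | ⟨x', hx', x, hx, y', y, hf, he, hF, -⟩)
    · have := hF.independent hG (.inl ⟨hx, hx'⟩)
      rw [← he, ← hf] at this
      exact this
    · have := hF.swap.independent hG (.inl ⟨hx, hx'⟩)
      rw [← he, ← hf] at this
      exact this
  · rintro e f ⟨x, hx, x', hx', y, y', he, hf, hF, h⟩ ⟨u, hu, u', hu', w, w', he', hf', hF', h'⟩
    obtain ⟨rfl, rfl⟩ := eq_of_mk_eq hG hx hu' hF.1 (he.symm.trans hf')
    obtain ⟨rfl, rfl⟩ := eq_of_mk_eq hG hx' hu hF.2.1 (hf.symm.trans he')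
    exact asymm _ _ h h'
  · rintro e f g ⟨x, hx, x', hx', y, y', he, hf, hF, h⟩ ⟨u, hu, u', hu', w, w', he', hf', hF', h'⟩
    obtain ⟨rfl, rfl⟩ := eq_of_mk_eq hG hx' hu hF.2.1 (hf.symm.trans he')
    have hy := hT.of_forces hG hD hF h
    have hy' := hT.of_forces hG hD hF' h'
    -- An edge joining the outer two edges would create a forcing step that reverses an oriented
    -- pair in `Y`.
    refine ⟨x, hx, u', hu', y, w', he, hf', ⟨hF.1, hF'.2.1, fun k => ?_, fun k => ?_⟩, ?_⟩
    · exact asymm _ _ hy' (hT.of_forces hG hD (a := x) (b := x') ⟨k, hF.2.1, hF.2.2.1, hF'.2.2.1⟩ h)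
    · exact asymm _ _ hy (hT.of_forces hG hD (a := x') (b := u')
        ⟨hF'.1, k, hF.2.2.2, hF'.2.2.2⟩ h')
    · have hne : x ≠ u' := by
        rintro rfl
        exact asymm _ _ h h'
      rcases hD.oriented x u' hne (.inl ⟨hx, hu'⟩) with k | k
      · exact k.1
      · exact (hA x (.tail (.tail (.single h) h') k.1)).elim

/-! ### Edge-asteroids and linked cycles -/

/-- The vertices that are adjacent to no end of `e`. -/
def farFrom (G : SimpleGraph V) (e : Sym2 V) : Set V := {w | ∀ c ∈ e, ¬ G.Adj w c}

theorem independent_of_subset_farFrom {e f : Sym2 V} (he : e ∈ G.edgeSet)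
    (h : ∀ w ∈ f, w ∈ farFrom G e) : Independent G e f := by
  intro a ha b hb
  refine ⟨?_, fun k => h b hb a ha k.symm⟩
  rintro rfl
  induction e using Sym2.ind with
  | _ u v =>
    have he : G.Adj u v := he
    rcases Sym2.mem_iff.1 ha with rfl | rfl
    · exact h _ hb v (by simp) he
    · exact h _ hb u (by simp) he.symm

theorem mem_farFrom_of_independent {e f : Sym2 V} (h : Independent G e f) {w : V} (hw : w ∈ f) :
    w ∈ farFrom G e := fun c hc k => (h c hc w hw).2 k.symm

theorem not_independent_of_mem {f g : Sym2 V} {a : V} (hf : a ∈ f) (hg : a ∈ g) :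
    ¬ Independent G f g := fun h => (h a hf a hg).1 rfl

theorem link_of_walk {e : G.edgeSet} {a b : V} (W : G.Walk a b)
    (hW : ∀ w ∈ W.support, w ∈ farFrom G e) (f g : G.edgeSet)
    (hf : ∀ w ∈ (f : Sym2 V), w ∈ farFrom G e)
    (hg : ∀ w ∈ (g : Sym2 V), w ∈ farFrom G e) (ha : a ∈ (f : Sym2 V)) (hb : b ∈ (g : Sym2 V)) :
    Link (independenceGraph G) e f g := by
  induction W generalizing f with
  | nil =>
    exact link_of_not_adj (independent_of_subset_farFrom e.2 hf)
      (independent_of_subset_farFrom e.2 hg) (not_independent_of_mem ha hb)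
  | @cons u v w hadj W ih =>
    simp only [SimpleGraph.Walk.support_cons, List.mem_cons, forall_eq_or_imp] at hW
    have hh : ∀ w ∈ s(u, v), w ∈ farFrom G e := by
      intro w hw
      rcases Sym2.mem_iff.1 hw with rfl | rfl
      · exact hW.1
      · exact hW.2 _ W.start_mem_support
    exact Link.trans (link_of_not_adj (independent_of_subset_farFrom e.2 hf)
      (independent_of_subset_farFrom e.2 hh) (not_independent_of_mem ha (by simp)))
      (ih hW.2 ⟨s(u, v), hadj⟩ hh (by simp) hb)

/-- By transitivity, whether `v` precedes its neighbour is constant along links around `v`. So the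
direction between `e i` and `e (i + k)` flips under the shift `i ↦ i + k + 1`, and `2k + 1` shifts
return to the start after an odd number of flips. -/
theorem IsComparabilityGraph.not_hasWeakEdgeAsteroid
    (h : IsComparabilityGraph (independenceGraph G)) : ¬ HasWeakEdgeAsteroid G := by
  rintro ⟨k, e, he⟩
  obtain ⟨r, hr, hasymm, htrans⟩ := h
  have hlink {v x y : G.edgeSet} (h : Link (independenceGraph G) v x y) (hx : r v x) : r v y := by
    induction h with
    | refl => exact hx
    | @tail x z _ h ih =>
      refine ((hr _ _).1 h.2.1).resolve_right fun k => h.2.2 ?_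
      exact ((hr _ _).2 (.inl (htrans _ _ _ k ih))).symm
  have hends (i : ZMod (2 * k + 1)) :
      (∀ w ∈ (e (i + k) : Sym2 V), w ∈ farFrom G (e i)) ∧
      (∀ w ∈ (e (i + k + 1) : Sym2 V), w ∈ farFrom G (e i)) := by
    obtain ⟨a, ha, b, hb, W, h₁, h₂, h₃⟩ := he i
    exact ⟨fun w hw => h₃ w (h₁ w hw), fun w hw => h₃ w (h₂ w hw)⟩
  have hl (i : ZMod (2 * k + 1)) : Link (independenceGraph G) (e i) (e (i + k)) (e (i + k + 1)) := by
    obtain ⟨a, ha, b, hb, W, h₁, h₂, h₃⟩ := he i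
    exact link_of_walk W h₃ _ _ (hends i).1 (hends i).2 ha hb
  have hflip (i : ZMod (2 * k + 1)) :
      r (e (i + (k + 1))) (e (i + (k + 1) + k)) ↔ ¬ r (e i) (e (i + k)) := by
    have hz : (2 * k + 1 : ZMod (2 * k + 1)) = 0 := by exact_mod_cast ZMod.natCast_self (2 * k + 1)
    have e₁ : i + (k + 1) + k = i := by linear_combination hz
    have hadj := independent_of_subset_farFrom (e i).2 (hends i).2
    rw [e₁, ← add_assoc]
    constructor
    · exact fun h₁ h₂ => hasymm _ _ h₁ (hlink (hl i) h₂)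
    · exact fun h => ((hr _ _).1 hadj).resolve_left fun h' => h (hlink (hl i).symm h')
  have hiter (n : ℕ) : r (e (n * (k + 1))) (e (n * (k + 1) + k)) ↔
      (Even n ↔ r (e 0) (e (0 + k))) := by
    induction n with
    | zero => simp
    | succ n ih =>
      have := hflip (n * (k + 1))
      push_cast
      rw [add_one_mul, this, ih, Nat.even_add_one]
      tauto
  have := hiter (2 * k + 1)
  rw [ZMod.natCast_self, zero_mul] at this
  have hodd : ¬ Even (2 * k + 1) := by simp
  tauto

/-- `a` and `b` are joined by a walk inside `S`. -/
def JoinedIn (G : SimpleGraph V) (S : Set V) (a b : V) : Prop :=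
  ∃ W : G.Walk a b, ∀ w ∈ W.support, w ∈ S

theorem JoinedIn.trans {S : Set V} {a b c : V} (h : JoinedIn G S a b) (h' : JoinedIn G S b c) :
    JoinedIn G S a c := by
  obtain ⟨W, hW⟩ := h
  obtain ⟨W', hW'⟩ := h'
  refine ⟨W.append W', fun w hw => ?_⟩
  rw [SimpleGraph.Walk.mem_support_append_iff] at hw
  exact hw.elim (hW w) (hW' w)

theorem JoinedIn.of_adj {S : Set V} {a b : V} (h : G.Adj a b) (ha : a ∈ S) (hb : b ∈ S) :
    JoinedIn G S a b :=
  ⟨.cons h .nil, by simp [ha, hb]⟩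

theorem joinedIn_of_mem {S : Set V} {f : Sym2 V} (hf : f ∈ G.edgeSet) (hS : ∀ w ∈ f, w ∈ S)
    {a b : V} (ha : a ∈ f) (hb : b ∈ f) : JoinedIn G S a b := by
  by_cases hab : a = b
  · subst hab
    exact ⟨.nil, by simp [hS a ha]⟩
  · rw [(Sym2.mem_and_mem_iff hab).1 ⟨ha, hb⟩] at hf
    exact .of_adj hf (hS a ha) (hS b hb)

theorem joinedIn_of_link {e f g : G.edgeSet} (h : Link (independenceGraph G) e f g)
    (hf : Independent G e f) {a b : V} (ha : a ∈ (f : Sym2 V)) (hb : b ∈ (g : Sym2 V)) :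
    JoinedIn G (farFrom G e) a b := by
  have far {f : G.edgeSet} (hf : Independent G e f) : ∀ w ∈ (f : Sym2 V), w ∈ farFrom G e :=
    fun w hw => mem_farFrom_of_independent hf hw
  induction h generalizing b with
  | refl => exact joinedIn_of_mem f.2 (far hf) ha hb
  | @tail g g' _ h ih =>
    obtain ⟨hg, hg', hn⟩ := h
    have hn' : ∃ c ∈ (g : Sym2 V), ∃ d ∈ (g' : Sym2 V), c = d ∨ G.Adj c d := by
      by_contra! k
      exact hn fun c hc d hd => k c hc d hd
    obtain ⟨c, hc, d, hd, hcd⟩ := hn'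
    have h₁ := ih hc
    have h₂ := joinedIn_of_mem g'.2 (far hg') hd hb
    rcases hcd with rfl | hcd
    · exact h₁.trans h₂
    · exact h₁.trans ((JoinedIn.of_adj hcd (far hg c hc) (far hg' d hd)).trans h₂)

/-- Modulo `2k + 1`, multiplication by `-2` sends `k` to `1` and `k + 1` to `-1`, so the edges
opposite to `e i` become the two cyclic neighbours of `f (-2 * i)`. -/
theorem IsLinkedCycle.isWeakEdgeAsteroid {k : ℕ} {f : ZMod (2 * k + 1) → G.edgeSet}
    (hf : IsLinkedCycle (independenceGraph G) k f) :
    IsWeakEdgeAsteroid G k fun i => f (-2 * i) := by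
  intro i
  have hz : (2 * k + 1 : ZMod (2 * k + 1)) = 0 := by exact_mod_cast ZMod.natCast_self (2 * k + 1)
  have e₁ : -2 * (i + k) = -2 * i + 1 := by linear_combination -hz
  have e₂ : -2 * (i + k + 1) = -2 * i - 1 := by linear_combination -hz
  simp only [e₁, e₂]
  obtain ⟨hadj, hl⟩ := hf (-2 * i)
  have hadj' := hl.adj hadj
  obtain ⟨⟨a, a'⟩, ha⟩ := Sym2.mk_surjective (f (-2 * i + 1) : Sym2 V)
  obtain ⟨⟨b, b'⟩, hb⟩ := Sym2.mk_surjective (f (-2 * i - 1) : Sym2 V)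
  have haf : a ∈ (f (-2 * i + 1) : Sym2 V) := by rw [← ha]; simp
  have haf' : a' ∈ (f (-2 * i + 1) : Sym2 V) := by rw [← ha]; simp
  have hbf : b ∈ (f (-2 * i - 1) : Sym2 V) := by rw [← hb]; simp
  have hbf' : b' ∈ (f (-2 * i - 1) : Sym2 V) := by rw [← hb]; simp
  obtain ⟨W₁, hW₁⟩ := joinedIn_of_mem (f (-2 * i + 1)).2
    (fun w hw => mem_farFrom_of_independent hadj hw) haf haf'
  obtain ⟨W₂, hW₂⟩ := joinedIn_of_link hl hadj haf' hbf
  obtain ⟨W₃, hW₃⟩ := joinedIn_of_mem (f (-2 * i - 1)).2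
    (fun w hw => mem_farFrom_of_independent hadj' hw) hbf hbf'
  refine ⟨a, haf, b', hbf', (W₁.append W₂).append W₃, ?_, ?_, ?_⟩
  · intro w hw
    rw [← ha] at hw
    simp only [SimpleGraph.Walk.mem_support_append_iff]
    rcases Sym2.mem_iff.1 hw with rfl | rfl
    · exact .inl (.inl W₁.start_mem_support)
    · exact .inl (.inl W₁.end_mem_support)
  · intro w hw
    rw [← hb] at hw
    simp only [SimpleGraph.Walk.mem_support_append_iff]
    rcases Sym2.mem_iff.1 hw with rfl | rfl
    · exact .inr W₃.start_mem_support
    · exact .inr W₃.end_mem_support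
  · intro w hw
    simp only [SimpleGraph.Walk.mem_support_append_iff] at hw
    rcases hw with (hw | hw) | hw
    · exact hW₁ w hw
    · exact hW₂ w hw
    · exact hW₃ w hw

theorem mul_neg_two_injective (k : ℕ) :
    Function.Injective fun i : ZMod (2 * k + 1) => -2 * i := by
  intro i j h
  have hz : (2 * k + 1 : ZMod (2 * k + 1)) = 0 := by exact_mod_cast ZMod.natCast_self (2 * k + 1)
  dsimp only at h
  linear_combination k * h + (i - j) * hz

/-! ### From a self-inverse class to an edge-asteroid -/

/-- The node of the split graph of `I(G)` that belongs to a forcing pair. -/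
def forcesNode {p q : V × V} (h : Forces G p q) : G.edgeSet × Set G.edgeSet :=
  node (independenceGraph G) ⟨s(p.1, q.1), h.1⟩ ⟨s(p.2, q.2), h.2.1⟩

/-- The edge `f` at `p.1` is also independent of `e'`. Since `e`, `f` share `p.1` and `e'`, `f'`
share `p.2`, the relevant copies of `e'` and of `f` coincide. -/
theorem hasWalk_forcesNode (hG : IsBipartition G X Y) {p q r : V × V}
    (hp : SameSide X Y p.1 p.2) (h : Forces G p q) (h' : Forces G p r) :
    HasWalk (splitGraph (independenceGraph G)) 2 (forcesNode h) (forcesNode h') := by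
  have hf : Forces G p (r.1, q.2) := ⟨h'.1, h.2.1, h.2.2.1, h'.2.2.2⟩
  set e : G.edgeSet := ⟨s(p.1, q.1), h.1⟩
  set e' : G.edgeSet := ⟨s(p.2, q.2), h.2.1⟩
  set f : G.edgeSet := ⟨s(p.1, r.1), h'.1⟩
  set f' : G.edgeSet := ⟨s(p.2, r.2), h'.2.1⟩
  have h₁ : (independenceGraph G).Adj e e' := h.independent hG hp
  have h₂ : (independenceGraph G).Adj f e' := hf.independent hG hp
  have h₃ : (independenceGraph G).Adj f f' := h'.independent hG hp
  have e₁ : node (independenceGraph G) e' e = node (independenceGraph G) e' f :=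
    node_eq_of_link (link_of_not_adj h₁.symm h₂.symm
      (not_independent_of_mem (a := p.1) (by simp [e]) (by simp [f])))
  have e₂ : node (independenceGraph G) f e' = node (independenceGraph G) f f' :=
    node_eq_of_link (link_of_not_adj h₂ h₃
      (not_independent_of_mem (a := p.2) (by simp [e']) (by simp [f'])))
  have w₁ := HasWalk.of_adj (splitGraph_adj h₁)
  have w₂ := HasWalk.of_adj (splitGraph_adj h₂.symm)
  rw [e₂, ← e₁] at w₂
  exact w₁.trans w₂

theorem exists_even_walk (hG : IsBipartition G X Y) {p q : V × V} (hpq : SameClass G p q)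
    (hp : SameSide X Y p.1 p.2) {p' q' : V × V} (h : Forces G p p') (h' : Forces G q q') :
    ∃ n, Even n ∧ HasWalk (splitGraph (independenceGraph G)) n (forcesNode h) (forcesNode h') := by
  induction hpq generalizing q' with
  | refl => exact ⟨2, even_two, hasWalk_forcesNode hG hp h h'⟩
  | @tail q r hpq hqr ih =>
    obtain ⟨n, hn, hw⟩ := ih hqr
    -- Reversing a forcing step keeps the two unordered edges, so consecutive walks of length two
    -- fit together.
    have e : forcesNode hqr = forcesNode hqr.symm := by
      simp only [forcesNode, Sym2.eq_swap]
    rw [e] at hw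
    exact ⟨n + 2, hn.add even_two, hw.trans (hasWalk_forcesNode hG
      (SameClass.sameSide hG (hpq.tail hqr) hp) hqr.symm h')⟩

theorem noSelfInverse_of_not_hasEdgeAsteroid (hG : IsBipartition G X Y)
    (h : ¬ HasEdgeAsteroid G) : NoSelfInverse G X Y := by
  intro a b hne hs hab
  rcases Relation.ReflTransGen.cases_head hab with e | ⟨q, hq, -⟩
  · exact hne (congrArg Prod.fst e)
  obtain ⟨n, hn, hw⟩ := exists_even_walk hG hab hs hq hq.swap
  -- The even walk joins the two ends of a single edge of the split graph, which closes it to an odd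
  -- walk.
  have hadj : (splitGraph (independenceGraph G)).Adj (forcesNode hq.swap) (forcesNode hq) :=
    splitGraph_adj (hq.swap.independent hG hs.symm)
  obtain ⟨k, f, hinj, hf⟩ := exists_injective_linkedCycle hn.add_one (hw.trans (.of_adj hadj))
  exact h ⟨k, _, hinj.comp (mul_neg_two_injective k), hf.isWeakEdgeAsteroid⟩

end Bigraph

theorem theorem3p7 {V : Type*} [Finite V] (G : SimpleGraph V) (X Y : Set V)
    (hG : Bigraph.IsBipartition G X Y) :
    List.TFAE [
      Bigraph.IsCocomparabilityBigraph G X Y,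
      ∃ D : V → V → Prop,
        Bigraph.IsOrientation X Y D ∧ Bigraph.Acyclic D ∧ Bigraph.TFree G X Y D,
      ∃ D : V → V → Prop, Bigraph.IsOrientation X Y D ∧ Bigraph.TFree G X Y D,
      ¬ ∃ u v : V, Bigraph.IsInvertiblePair G X Y u v,
      ¬ Bigraph.HasWeakEdgeAsteroid G,
      ¬ Bigraph.HasEdgeAsteroid G,
      Bigraph.IsComparabilityGraph (Bigraph.independenceGraph G)] := by
  rw [← Bigraph.noSelfInverse_iff hG]
  tfae_have 1 → 2 := Bigraph.exists_acyclic_tFree hG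
  tfae_have 2 → 3 := fun ⟨D, h₁, _, h₃⟩ => ⟨D, h₁, h₃⟩
  tfae_have 3 → 4 := fun ⟨_, h₁, h₂⟩ => Bigraph.noSelfInverse_of_tFree hG h₁ h₂
  tfae_have 4 → 1 := Bigraph.isCocomparabilityBigraph_of_noSelfInverse hG
  tfae_have 2 → 7 := fun ⟨_, h₁, h₂, h₃⟩ =>
    Bigraph.isComparabilityGraph_independenceGraph hG h₁ h₂ h₃
  tfae_have 7 → 5 := Bigraph.IsComparabilityGraph.not_hasWeakEdgeAsteroid
  tfae_have 5 → 6 := fun h ⟨k, e, _, he⟩ => h ⟨k, e, he⟩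
  tfae_have 6 → 4 := Bigraph.noSelfInverse_of_not_hasEdgeAsteroid hG
  tfae_finish
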